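/- Let $N\ge 3$, let $\mathcal A=\{1,\dots,N\}$ be the set of actors and $\mathcal O=\{-1,+1\}$ the set of opinions, and let $\mathcal S=\{u\in\mathbb Z^N:\min_{a}|u(a)|=0\}$. For $a\in\mathcal A$, $o\in\mathcal O$ and $u\in\mathcal S$, let $\pi^{a,o}(u)\in\mathcal S$ be the list with $\pi^{a,o}(u)(a)=0$ and $\pi^{a,o}(u)(b)=u(b)+o$ for $b\ne a$. For $\beta\ge 0$ and $u\in\mathcal S$, let $(U^{\beta,u}_t)_{t\ge 0}$ be the Markov jump process on $\mathcal S$ that starts from $u$ and evolves as follows: when the current list is $v$, independent exponential random times with parameters $\exp(\beta\, o\, v(a))$ are attached to the pairs $(a,o)\in\mathcal A\times\mathcal O$, and at the smallest of these times, attained by the pair $(A,O)$, the list changes from $v$ to $\pi^{A,O}(v)$; then the procedure starts afresh from the new list. For $B\subset\mathcal S$ let $R^{\beta,u}(B)=\inf\{t>0: U^{\beta,u}_t\in B\}$. Let $$\mathcal L^+=\{u\in\mathcal S:\{u(1),\dots,u(N)\}=\{0,1,\dots,N-1\}\},\qquad \mathcal L^-=\{u\in\mathcal S:\{u(1),\dots,u(N)\}=\{0,-1,\dots,-(N-1)\}\}.$$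 Proposition. For every $\beta\ge 0$ and every $l\in\mathcal L^+$ the time $R^{\beta,l}(\mathcal L^-)$ is almost surely finite, and there is a unique positive real number $c_\beta$, the same for all $l\in\mathcal L^+$, such that $$\mathbb P\big(R^{\beta,l}(\mathcal L^-)>c_\beta\big)=e^{-1}.$$ Moreover, for every $l\in\mathcal L^+$, $$\frac{R^{\beta,l}(\mathcal L^-)}{c_\beta}\longrightarrow \mathrm{Exp}(1)\quad\text{in distribution, as }\beta\to+\infty,$$ where $\mathrm{Exp}(1)$ denotes the exponential distribution with mean $1$. -/

import Mathlib

open MeasureTheory ProbabilityTheory Filter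
open scoped NNReal ENNReal

noncomputable section

namespace SocialNetwork

/-- A (social actor, opinion) pair: the actors are `Fin N`, and the set of opinions `{-1, +1}` is
`ℤˣ`, the group of units of `ℤ`. -/
abbrev Mark (N : ℕ) : Type := Fin N × ℤˣ

/-- The set `𝓢` of lists of social pressures: integer lists with `min |u(a)| = 0`, that is, with at
least one null entry. -/
def lists (N : ℕ) : Set (Fin N → ℤ) := {u | ∃ a, u a = 0}

/-- Positive ladder lists: the set of values is `{0, 1, ..., N - 1}`. -/
def posLadder (N : ℕ) : Set (Fin N → ℤ) :=
  {u | u ∈ lists N ∧ Set.range u = {k : ℤ | 0 ≤ k ∧ k ≤ (N : ℤ) - 1}}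

/-- Negative ladder lists: the set of values is `{0, -1, ..., -(N - 1)}`. -/
def negLadder (N : ℕ) : Set (Fin N → ℤ) :=
  {u | u ∈ lists N ∧ Set.range u = {k : ℤ | -((N : ℤ) - 1) ≤ k ∧ k ≤ 0}}

/-- The map `π^{a,o}`: actor `a` expresses opinion `o`, the pressure on `a` is reset to `0` and
the pressure on every other actor changes by `o`. -/
def express {N : ℕ} (p : Mark N) (u : Fin N → ℤ) : Fin N → ℤ :=
  fun b => if b = p.1 then 0 else u b + (p.2 : ℤ)

theorem express_mem_lists {N : ℕ} (p : Mark N) (u : Fin N → ℤ) : express p u ∈ lists N :=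
  ⟨p.1, by simp [express]⟩

/-- The rate `exp(β o u(a))` at which actor `a` expresses opinion `o` under the list `u`. -/
def rate {N : ℕ} (β : ℝ≥0) (u : Fin N → ℤ) (p : Mark N) : ℝ :=
  Real.exp ((β : ℝ) * ((p.2 : ℤ) : ℝ) * (u p.1 : ℝ))

/-- The sample space: a real number for every step and every (actor, opinion) pair. -/
abbrev Sample (N : ℕ) : Type := ℕ → Mark N → ℝ

instance isProbabilityMeasure_exp_one : IsProbabilityMeasure (expMeasure 1) :=
  isProbabilityMeasure_expMeasure one_pos

/-- The law under which all the coordinates are independent mean one exponential variables. -/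
def prob (N : ℕ) : Measure (Sample N) :=
  Measure.infinitePi fun _ : ℕ => Measure.pi fun _ : Mark N => expMeasure 1

instance isProbabilityMeasure_prob (N : ℕ) : IsProbabilityMeasure (prob N) := by
  unfold prob; infer_instance

/-- The exponential times attached to the (actor, opinion) pairs at the current list `v`, made from
mean one exponential times `ξ`: dividing by the rate `r` gives an exponential time of parameter
`r`. -/
def clock {N : ℕ} (β : ℝ≥0) (v : Fin N → ℤ) (ξ : Mark N → ℝ) (p : Mark N) : ℝ :=
  ξ p / rate β v p

/-- The pair whose clock rings first (almost surely there is only one such pair). -/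
def first {N : ℕ} [NeZero N] (x : Mark N → ℝ) : Mark N :=
  Classical.choose (Finite.exists_min x)

theorem first_le {N : ℕ} [NeZero N] (x : Mark N → ℝ) (p : Mark N) : x (first x) ≤ x p :=
  Classical.choose_spec (Finite.exists_min x) p

/-- The embedded chain: the list of social pressures after `n` opinions, starting from `u`. -/
def chain {N : ℕ} [NeZero N] (β : ℝ≥0) (u : Fin N → ℤ) (ω : Sample N) : ℕ → Fin N → ℤ
  | 0 => u
  | n + 1 => express (first (clock β (chain β u ω n) (ω n))) (chain β u ω n)

/-- The time `T_n` at which the `n`-th opinion is expressed, with `T_0 = 0`. -/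
def jumpTime {N : ℕ} [NeZero N] (β : ℝ≥0) (u : Fin N → ℤ) (ω : Sample N) : ℕ → ℝ
  | 0 => 0
  | n + 1 => jumpTime β u ω n +
      clock β (chain β u ω n) (ω n) (first (clock β (chain β u ω n) (ω n)))

/-- The list `U_t` of social pressures at time `t`, namely `chain β u ω m` for
`T_m ≤ t < T_{m+1}`. (The `sSup` is junk only at times `t ≥ sup T_m`, which almost surely do not
exist.) -/
def pressure {N : ℕ} [NeZero N] (β : ℝ≥0) (u : Fin N → ℤ) (ω : Sample N) (t : ℝ) : Fin N → ℤ :=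
  chain β u ω (sSup {m : ℕ | jumpTime β u ω m ≤ t})

theorem pressure_eq {N : ℕ} [NeZero N] (β : ℝ≥0) (u : Fin N → ℤ) (ω : Sample N) {t : ℝ} {m : ℕ}
    (hmono : Monotone (jumpTime β u ω)) (h₁ : jumpTime β u ω m ≤ t)
    (h₂ : t < jumpTime β u ω (m + 1)) : pressure β u ω t = chain β u ω m := by
  have hub : ∀ k ∈ {k : ℕ | jumpTime β u ω k ≤ t}, k ≤ m := by
    intro k hk
    by_contra hlt
    have := hmono (show m + 1 ≤ k by omega)
    have hk' : jumpTime β u ω k ≤ t := hk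
    linarith
  have hg : IsGreatest {k : ℕ | jumpTime β u ω k ≤ t} m := ⟨h₁, hub⟩
  have hs : sSup {k : ℕ | jumpTime β u ω k ≤ t} = m := hg.csSup_eq
  rw [pressure, hs]

/-- The reaching time `R^{β,u}(B) = inf {t > 0 : U_t ∈ B}`, equal to `∞` when `B` is never
reached. -/
def reachTime {N : ℕ} [NeZero N] (β : ℝ≥0) (u : Fin N → ℤ) (B : Set (Fin N → ℤ))
    (ω : Sample N) : ℝ≥0∞ :=
  sInf (ENNReal.ofReal '' {t : ℝ | 0 < t ∧ pressure β u ω t ∈ B})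

end SocialNetwork

end

/-!
The reaching time is studied by first-step analysis. Write `r p` for the rate of a move `p` under
the list `u`, and `Λ` for the sum of the rates. At the first jump, the pair which acts, the time of
the jump and the future are independent (`map_jump_prob`), so the characteristic function `ψ u` of the
hitting time of the negative ladders solves `(Λ - i t) ψ u = ∑ p, r p * ψ (express p u)` off these
ladders (`resolvent_charFun_hitLaw`). The main tool is a maximum principle for the embedded chain,
valid for every `β`: a bounded function, subharmonic off a set containing the negative ladders and
nonpositive on this set, is nonpositive (`nonpos_of_subharmonic`). It gives the almost sure
finiteness of the hitting time (`ae_hitTime_lt_top`), and the fact that its law is the same from all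
positive ladders, which are exchanged by permutations of the actors (`hitLaw_comp_perm`). This law has no atoms and charges all
intervals of positive reals, hence it has a unique quantile (`exists_quantile_hitLaw`).

When `β` is large, moves of maximal rate dominate. A bounded number of them leads from any list to a
ladder (`mem_forcedIn_ladders`): they first bring all entries below `N`, then shrink the spread of a
list that has entries of both signs, and finally build a ladder one step at a time out of a list of
constant sign. Counting these moves, with weights, gives a Lyapunov function `lyap` that bounds the
expected time to reach the ladders (`lyap_drift`). At a positive ladder the sum `∑ p, r p * lyap`
tends to zero (`lyap_bound_at_posLadder`), although the rates diverge: an excursion started by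
the opinion `+1` has rate at most `exp (β (N - 2))` and consists, until the opinion `-1` is
expressed, of lists without repetition whose largest entry is at least `N`, so that it has duration
of order `exp (-β N)`; the other excursions start at rate at most one.

Let `κ` be the rate at which a positive ladder starts an excursion that ends on a negative ladder
(`crossRate`). From a list `v`, the value `ψ v` is the average of `1` and of the value `a` of `ψ` on
the positive ladders, with the probabilities of the two outcomes as weights, up to `|t| * lyap β v`
(`norm_charFun_sub_le`). Inserting this in the equation at a positive ladder yields
`a * (κ - i t) = κ`, up to a small multiple of `|t|` (`norm_charFun_mul_sub_le`). Hence `κ` times the hitting time converges in law to the exponential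
distribution of mean one, by Lévy's theorem; the quantile is then equivalent to `1 / κ`
(`tendsto_quantile_mul_crossRate`), and one may normalize by the quantile instead.
-/

noncomputable section

namespace SocialNetwork

variable {N : ℕ}

/-! ### Moves of maximal rate lead to ladders -/

/-- The set of all ladder lists, positive and negative. -/
def ladders (N : ℕ) : Set (Fin N → ℤ) := posLadder N ∪ negLadder N

/-- An (actor, opinion) pair of maximal rate under the list `u`: the product `o * u a` equals
`max |u|`. -/
def IsTop (u : Fin N → ℤ) (p : Mark N) : Prop := ∀ b, |u b| ≤ (p.2 : ℤ) * u p.1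

theorem units_mul_self_le_abs (s : ℤˣ) (k : ℤ) : (s : ℤ) * k ≤ |k| := by
  rcases Int.units_eq_one_or s with rfl | rfl
  · simpa using le_abs_self k
  · simpa using neg_le_abs k

theorem exists_isTop [NeZero N] (u : Fin N → ℤ) : ∃ p, IsTop u p := by
  obtain ⟨a, ha⟩ := Finite.exists_max fun a => |u a|
  rcases abs_choice (u a) with h | h
  · exact ⟨(a, 1), fun b => by simpa using (ha b).trans h.le⟩
  · exact ⟨(a, -1), fun b => by simpa using (ha b).trans h.le⟩

/-- The lists from which every sequence of `n` moves of maximal rate visits `B`. -/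
def forcedIn (B : Set (Fin N → ℤ)) : ℕ → Set (Fin N → ℤ)
  | 0 => B
  | n + 1 => {u | u ∈ B ∨ ∀ p, IsTop u p → express p u ∈ forcedIn B n}

theorem subset_forcedIn (B : Set (Fin N → ℤ)) (n : ℕ) : B ⊆ forcedIn B n := by
  cases n with
  | zero => exact subset_rfl
  | succ n => exact fun u hu => Or.inl hu

theorem forcedIn_subset_succ (B : Set (Fin N → ℤ)) (n : ℕ) :
    forcedIn B n ⊆ forcedIn B (n + 1) := by
  induction n with
  | zero => exact subset_forcedIn B 1
  | succ n ih =>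
    rintro u (hu | hu)
    · exact Or.inl hu
    · exact Or.inr fun p hp => ih (hu p hp)

theorem forcedIn_mono (B : Set (Fin N → ℤ)) : Monotone (forcedIn B) :=
  monotone_nat_of_le_succ (forcedIn_subset_succ B)

theorem forcedIn_trans {B C : Set (Fin N → ℤ)} {n k : ℕ} {u : Fin N → ℤ}
    (hu : u ∈ forcedIn B n) (hB : ∀ v ∈ B, v ∈ lists N → v ∈ forcedIn C k) (hl : u ∈ lists N) :
    u ∈ forcedIn C (n + k) := by
  induction n generalizing u with
  | zero => simpa using hB u hu hl
  | succ n ih =>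
    rw [Nat.add_right_comm]
    rcases hu with hu | hu
    · exact forcedIn_mono C (by omega) (hB u hu hl)
    · exact Or.inr fun p hp => ih (hu p hp) (express_mem_lists p u)

/-- The list `s • u` is nonnegative, and it takes each of the values `0, ..., k - 1` exactly
once. -/
def PartialLadder (s : ℤˣ) (k : ℕ) (u : Fin N → ℤ) : Prop :=
  (∀ b, 0 ≤ (s : ℤ) * u b) ∧ ∀ j < k, ∃! b, (s : ℤ) * u b = (j : ℤ)

theorem units_mul_express_of_eq (s : ℤˣ) (a b : Fin N) (u : Fin N → ℤ) :
    (s : ℤ) * express (a, s) u b = if b = a then 0 else (s : ℤ) * u b + 1 := by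
  have hs : (s : ℤ) * s = 1 := by rw [← Units.val_mul, Int.units_mul_self, Units.val_one]
  by_cases h : b = a <;> simp [express, h, mul_add, hs]

theorem units_eq_of_mul_pos {s o : ℤˣ} {k : ℤ} (hs : 0 ≤ (s : ℤ) * k) (ho : 0 < (o : ℤ) * k) :
    o = s := by
  rcases Int.units_eq_one_or s with rfl | rfl <;> rcases Int.units_eq_one_or o with rfl | rfl <;>
    simp_all <;> omega

theorem PartialLadder.mem_ladder {s : ℤˣ} {u : Fin N → ℤ} [NeZero N] (h : PartialLadder s N u) :
    u ∈ lists N ∧ Set.range (fun b => (s : ℤ) * u b) = {k : ℤ | 0 ≤ k ∧ k ≤ (N : ℤ) - 1} := by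
  obtain ⟨h0, h1⟩ := h
  have hN : 0 < N := Nat.pos_of_ne_zero (NeZero.ne N)
  constructor
  · obtain ⟨b, hb, -⟩ := h1 0 hN
    refine ⟨b, ?_⟩
    simpa using hb
  · choose g hg hg' using fun j : Fin N => h1 j j.2
    have hinj : Function.Injective g := by
      intro i j hij
      have hi := hg i
      have hj := hg j
      simp only at hi hj
      rw [hij, hj] at hi
      exact Fin.ext (by exact_mod_cast hi.symm)
    have hsurj := (Finite.injective_iff_surjective.1 hinj)
    ext k
    simp only [Set.mem_range, Set.mem_ofPred_eq]
    constructor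
    · rintro ⟨b, rfl⟩
      obtain ⟨j, rfl⟩ := hsurj b
      have hj := hg j
      simp only at hj
      have := j.2
      rw [hj]; omega
    · rintro ⟨hk, hk'⟩
      lift k to ℕ using hk
      exact ⟨g ⟨k, by omega⟩, hg ⟨k, by omega⟩⟩

theorem mem_ladders_iff {u : Fin N → ℤ} : u ∈ ladders N ↔ u ∈ lists N ∧ ∃ s : ℤˣ,
    Set.range (fun b => (s : ℤ) * u b) = {k : ℤ | 0 ≤ k ∧ k ≤ (N : ℤ) - 1} := by
  have key : Set.range (fun b => -u b) = {k : ℤ | 0 ≤ k ∧ k ≤ (N : ℤ) - 1} ↔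
      Set.range u = {k : ℤ | -((N : ℤ) - 1) ≤ k ∧ k ≤ 0} := by
    have h1 : Set.range (fun b => -u b) = -Set.range u := by
      ext k; simp [neg_eq_iff_eq_neg]
    rw [h1, neg_eq_iff_eq_neg]
    have h2 : -{k : ℤ | 0 ≤ k ∧ k ≤ (N : ℤ) - 1} = {k : ℤ | -((N : ℤ) - 1) ≤ k ∧ k ≤ 0} := by
      ext k; simp only [Set.mem_neg, Set.mem_ofPred_eq]; omega
    rw [h2]
  constructor
  · rintro (⟨h, h'⟩ | ⟨h, h'⟩)
    · exact ⟨h, 1, by simpa using h'⟩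
    · exact ⟨h, -1, by simpa using key.2 h'⟩
  · rintro ⟨h, s, hs⟩
    rcases Int.units_eq_one_or s with rfl | rfl
    · exact Or.inl ⟨h, by simpa using hs⟩
    · exact Or.inr ⟨h, key.1 (by simpa using hs)⟩

/-- A partial ladder has fewer than `N` small entries, so that a move of maximal rate is made by an
actor above the ladder; the move inserts that actor at the bottom and lifts the rest. -/
theorem PartialLadder.express {s : ℤˣ} {k : ℕ} {u : Fin N → ℤ} (h : PartialLadder s k u)
    (hk : 1 ≤ k) (hkN : k < N) {p : Mark N} (hp : IsTop u p) :
    PartialLadder s (k + 1) (express p u) := by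
  obtain ⟨h0, h1⟩ := h
  obtain ⟨a, o⟩ := p
  have hbig : ∃ b, (k : ℤ) ≤ (s : ℤ) * u b := by
    by_contra! hlt
    have hmaps : ∀ b : Fin N, b ∈ (Finset.univ : Finset (Fin N)) →
        ((s : ℤ) * u b).toNat ∈ Finset.range k := by
      intro b _
      have := hlt b
      have := h0 b
      simp only [Finset.mem_range]; omega
    obtain ⟨b, -, c, -, hbc, hEq⟩ :=
      Finset.exists_ne_map_eq_of_card_lt_of_maps_to (by simpa using hkN) hmaps
    have hb := h0 b
    have hc := h0 c
    have hb' := hlt b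
    obtain ⟨d, -, hd⟩ := h1 ((s : ℤ) * u b).toNat (by omega)
    exact hbc ((hd b (by simp only; omega)).trans (hd c (by simp only; omega)).symm)
  obtain ⟨b₀, hb₀⟩ := hbig
  have hle : |u b₀| ≤ (o : ℤ) * u a := hp b₀
  have hs₀ := units_mul_self_le_abs s (u b₀)
  have hos : o = s := units_eq_of_mul_pos (h0 a) (by omega)
  subst hos
  have hval := fun b => units_mul_express_of_eq o a b u
  refine ⟨fun b => ?_, fun j hj => ?_⟩
  · rw [hval]; split_ifs
    · exact le_rfl
    · have := h0 b; omega
  · rcases Nat.eq_zero_or_pos j with rfl | hjpos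
    · refine ⟨a, by simp [hval], fun c hc => ?_⟩
      by_contra hca
      simp only [hval, if_neg hca] at hc
      have := h0 c
      simp only [Nat.cast_zero] at hc
      omega
    · obtain ⟨b, hb, hb'⟩ := h1 (j - 1) (by omega)
      have hba : b ≠ a := by
        rintro rfl
        omega
      refine ⟨b, ?_, fun c hc => ?_⟩
      · simp only [hval, if_neg hba]; omega
      · by_cases hca : c = a
        · simp only [hval, if_pos hca] at hc; omega
        · simp only [hval, if_neg hca] at hc
          exact hb' c (by simp only; omega)

theorem PartialLadder.mem_forcedIn [NeZero N] {s : ℤˣ} {k n : ℕ} {u : Fin N → ℤ}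
    (h : PartialLadder s k u) (hk : 1 ≤ k) (hn : k + n = N) : u ∈ forcedIn (ladders N) n := by
  induction n generalizing k u with
  | zero =>
    obtain rfl : k = N := by omega
    obtain ⟨h1, h2⟩ := h.mem_ladder
    exact mem_ladders_iff.2 ⟨h1, s, h2⟩
  | succ n ih => exact Or.inr fun p hp => ih (h.express hk (by omega) hp) (by omega) (by omega)

/-- A nonzero list of constant sign becomes a partial ladder of length one after a move of maximal
rate, and therefore a ladder after `N` of them. -/
theorem mem_forcedIn_of_sign [NeZero N] {s : ℤˣ} {u : Fin N → ℤ} (h : ∀ b, 0 ≤ (s : ℤ) * u b)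
    (hu : u ≠ 0) : u ∈ forcedIn (ladders N) N := by
  have hN : 0 < N := Nat.pos_of_ne_zero (NeZero.ne N)
  obtain ⟨n, rfl⟩ : ∃ n, N = n + 1 := ⟨N - 1, by omega⟩
  refine Or.inr fun p hp => ?_
  obtain ⟨a, o⟩ := p
  obtain ⟨c, hc⟩ := Function.ne_iff.1 hu
  have hc' : 0 < |u c| := abs_pos.2 hc
  have hle : |u c| ≤ (o : ℤ) * u a := hp c
  have hos : o = s := units_eq_of_mul_pos (h a) (by omega)
  subst hos
  have hval := fun b => units_mul_express_of_eq o a b u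
  refine PartialLadder.mem_forcedIn (s := o) (k := 1) ⟨fun b => ?_, fun j hj => ?_⟩ le_rfl
    (by omega)
  · rw [hval]; split_ifs
    · exact le_rfl
    · have := h b; omega
  · obtain rfl : j = 0 := by omega
    refine ⟨a, by simp [hval], fun d hd => ?_⟩
    by_contra hda
    simp only [hval, if_neg hda, Nat.cast_zero] at hd
    have := h d
    omega

/-- A move of maximal rate from a nonzero list does not lead to the null list. -/
theorem express_ne_zero_of_isTop {u : Fin N → ℤ} (hl : u ∈ lists N) (hu : u ≠ 0) {p : Mark N}
    (hp : IsTop u p) : express p u ≠ 0 := by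
  obtain ⟨z, hz⟩ := hl
  obtain ⟨c, hc⟩ := Function.ne_iff.1 hu
  have hc' : 0 < |u c| := abs_pos.2 hc
  have hle := hp c
  have hza : z ≠ p.1 := by
    rintro rfl
    rw [hz, mul_zero] at hle
    omega
  refine Function.ne_iff.2 ⟨z, ?_⟩
  simp [express, hza, hz]

/-- Let `|u| < k` on a set of `k` actors. If some entry is at least `N` in absolute value, a move of
maximal rate is made by an actor outside this set, and adding this actor gives a set of `k + 1`
actors with entries below `k + 1`. -/
theorem mem_forcedIn_small {k n : ℕ} {u : Fin N → ℤ} (hn : k + n = N)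
    (h : ∃ F : Finset (Fin N), F.card = k ∧ ∀ b ∈ F, |u b| < k) :
    u ∈ forcedIn {v : Fin N → ℤ | ∀ b, |v b| < N} n := by
  induction n generalizing k u with
  | zero =>
    obtain ⟨F, hF, h⟩ := h
    have : F = Finset.univ := Finset.eq_univ_of_card F (by simp [hF, ← hn])
    intro b
    have := h b (by simp [this])
    omega
  | succ n ih =>
    obtain ⟨F, hF, h⟩ := h
    by_cases hall : ∀ b, |u b| < N
    · exact Or.inl hall
    refine Or.inr fun p hp => ih (k := k + 1) (by omega) ?_
    push Not at hall
    obtain ⟨c, hc⟩ := hall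
    have hpF : p.1 ∉ F := by
      intro hmem
      have h1 := h _ hmem
      have h2 := hp c
      have h3 := units_mul_self_le_abs p.2 (u p.1)
      omega
    refine ⟨insert p.1 F, by rw [Finset.card_insert_of_notMem hpF, hF], fun b hb => ?_⟩
    by_cases hba : b = p.1
    · simp only [express, if_pos hba, abs_zero]; omega
    · have h1 := h b (by simpa [hba] using hb)
      have h2 : |u b + (p.2 : ℤ)| ≤ |u b| + 1 := by
        refine (abs_add_le _ _).trans ?_
        rcases Int.units_eq_one_or p.2 with h | h <;> simp [h]
      simp only [express, if_neg hba]
      push_cast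
      omega

theorem mem_forcedIn_small_of_mem_lists {u : Fin N → ℤ} (hu : u ∈ lists N) :
    u ∈ forcedIn {v : Fin N → ℤ | ∀ b, |v b| < N} N := by
  obtain ⟨z, hz⟩ := hu
  have : 0 < N := z.pos
  exact forcedIn_mono _ (Nat.sub_le N 1)
    (mem_forcedIn_small (k := 1) (by omega) ⟨{z}, by simp, by simp [hz]⟩)

/-- The actors whose entry is at distance `W` from some other entry. When `W` is the spread
`max u - min u`, these are the actors with an extreme entry. -/
def extremes (u : Fin N → ℤ) (W : ℕ) : Finset (Fin N) :=
  {b | ∃ c, |u b - u c| = W}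

theorem mem_extremes {u : Fin N → ℤ} {W : ℕ} {b : Fin N} :
    b ∈ extremes u W ↔ ∃ c, |u b - u c| = W := by
  simp [extremes]

theorem express_eq_of_ne {p : Mark N} {u : Fin N → ℤ} {b : Fin N} (h : b ≠ p.1) :
    express p u b = u b + (p.2 : ℤ) := by
  simp [express, h]

theorem express_self (p : Mark N) (u : Fin N → ℤ) : express p u p.1 = 0 := by
  simp [express]

theorem express_sub_express {p : Mark N} {u : Fin N → ℤ} {b c : Fin N} (hb : b ≠ p.1)
    (hc : c ≠ p.1) : express p u b - express p u c = u b - u c := by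
  rw [express_eq_of_ne hb, express_eq_of_ne hc]; ring

/-- If a list of spread at most `W` still has, after a move of maximal rate, an entry of the sign
opposite to the opinion expressed, then all entries of the new list are below `W` in absolute value.
As the actor who moved has entry `0`, this actor is not extreme in the new list. -/
theorem abs_express_lt {u : Fin N → ℤ} {W : ℕ} (hW : ∀ b c, |u b - u c| ≤ W) {p : Mark N}
    (hp : IsTop u p) (hl : ∃ b, u b ≠ 0)
    (hmix : ∃ c, (p.2 : ℤ) * express p u c < 0) {b : Fin N} : |express p u b| < W := by
  obtain ⟨a, o⟩ := p
  obtain ⟨c, hc⟩ := hmix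
  obtain ⟨d, hd⟩ := hl
  have hd' : 0 < |u d| := abs_pos.2 hd
  have hca : c ≠ a := by
    rintro rfl
    simp [express] at hc
  have hcv : express (a, o) u c = u c + (o : ℤ) := express_eq_of_ne hca
  rw [hcv] at hc
  have h1 := hp b
  have h2 := hp d
  have h3 := abs_le.1 (hW a c)
  have h4 := abs_le.1 (hW a b)
  rcases eq_or_ne b a with rfl | hba
  · rw [show express (b, o) u b = 0 from express_self (b, o) u, abs_zero]
    rcases Int.units_eq_one_or o with rfl | rfl <;> simp at hc h2 <;> omega
  · have hbv : express (a, o) u b = u b + (o : ℤ) := express_eq_of_ne hba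
    rw [hbv, abs_lt]
    have h1' := abs_le.1 h1
    rcases Int.units_eq_one_or o with rfl | rfl <;> simp at hc h1' h2 ⊢ <;> omega

theorem mem_extremes_of_isTop {u : Fin N → ℤ} {W : ℕ} (hW : ∀ b c, |u b - u c| ≤ W) {p : Mark N}
    (hp : IsTop u p) {b c : Fin N} (hbc : |u b - u c| = W) : p.1 ∈ extremes u W := by
  obtain ⟨a, o⟩ := p
  rw [mem_extremes]
  have h1 := abs_le.1 (hp b)
  have h2 := abs_le.1 (hp c)
  have h3 := abs_le.1 (hW a c)
  have h4 := abs_le.1 (hW a b)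
  simp only at h1 h2 ⊢
  rcases abs_choice (u b - u c) with h | h <;> rw [h] at hbc <;>
    rcases Int.units_eq_one_or o with rfl | rfl <;> simp at h1 h2
  · exact ⟨c, by rw [abs_eq (by omega)]; omega⟩
  · exact ⟨b, by rw [abs_eq (by omega)]; omega⟩
  · exact ⟨b, by rw [abs_eq (by omega)]; omega⟩
  · exact ⟨c, by rw [abs_eq (by omega)]; omega⟩

theorem zero_mem_forcedIn [NeZero N] (hN : 2 ≤ N) :
    (0 : Fin N → ℤ) ∈ forcedIn (ladders N) (N + 1) := by
  refine Or.inr fun p _ => ?_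
  have hs : (p.2 : ℤ) * p.2 = 1 := by rw [← Units.val_mul, Int.units_mul_self, Units.val_one]
  refine mem_forcedIn_of_sign (s := p.2) (fun b => ?_) ?_
  · rcases eq_or_ne b p.1 with h | h
    · rw [h, express_self, mul_zero]
    · rw [express_eq_of_ne h]; simp [hs]
  · have : Nontrivial (Fin N) := Fin.nontrivial_iff_two_le.2 hN
    obtain ⟨b, hb⟩ := exists_ne p.1
    refine Function.ne_iff.2 ⟨b, ?_⟩
    simp [express_eq_of_ne hb]

/-- Along moves of maximal rate between lists of two signs, the spread `max u - min u` does not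
increase, and the number of extreme entries decreases as long as the spread is unchanged. -/
theorem mem_forcedIn_of_spread [NeZero N] (hN : 2 ≤ N) (W : ℕ) : ∀ (k : ℕ) (u : Fin N → ℤ),
    u ∈ lists N → (∀ b c, |u b - u c| ≤ W) → (extremes u W).card ≤ k →
    u ∈ forcedIn (ladders N) (N + 1 + (N + 1) * W + k) := by
  induction W with
  | zero =>
    intro k u hu hW _
    obtain ⟨z, hz⟩ := hu
    have h0 : u = 0 := by
      funext b
      have := hW b z
      rw [hz] at this
      simpa using this
    rw [h0]
    exact forcedIn_mono _ (by omega) (zero_mem_forcedIn hN)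
  | succ W ihW =>
    intro k
    have hsmall : ∀ (k : ℕ) (u : Fin N → ℤ), u ∈ lists N → (∀ b c, |u b - u c| ≤ (W + 1 : ℕ)) →
        (∀ b c, |u b - u c| ≠ (W + 1 : ℕ)) →
        u ∈ forcedIn (ladders N) (N + 1 + (N + 1) * (W + 1) + k) := by
      intro k u hu hW hno
      refine forcedIn_mono _ (by ring_nf; omega) (ihW N u hu (fun b c => ?_) ?_)
      · have h1 := hW b c
        have h2 := hno b c
        push_cast at h1 h2 ⊢
        omega
      · simpa using Finset.card_le_univ (extremes u W)
    induction k with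
    | zero =>
      intro u hu hW hk
      refine hsmall 0 u hu hW fun b c hbc => ?_
      have : b ∈ extremes u (W + 1) := mem_extremes.2 ⟨c, hbc⟩
      rw [Finset.card_eq_zero.1 (Nat.le_zero.1 hk)] at this
      simp at this
    | succ k ihk =>
      intro u hu hW hk
      by_cases hno : ∀ b c, |u b - u c| ≠ (W + 1 : ℕ)
      · exact hsmall _ u hu hW hno
      push Not at hno
      obtain ⟨b, c, hbc⟩ := hno
      have hne : ∃ d, u d ≠ 0 := by
        by_contra! h
        rw [h b, h c] at hbc
        simp at hbc
        omega
      refine Or.inr fun p hp => ?_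
      have hwl := express_mem_lists p u
      have hw0 := express_ne_zero_of_isTop hu (Function.ne_iff.2 hne) hp
      by_cases hsign : ∀ c, 0 ≤ (p.2 : ℤ) * express p u c
      · exact forcedIn_mono _ (show N ≤ N + 1 + (N + 1) * (W + 1) + k by omega)
          (mem_forcedIn_of_sign hsign hw0)
      push Not at hsign
      have hlt : ∀ b, |express p u b| < (W + 1 : ℕ) := fun b => abs_express_lt hW hp hne hsign
      have hpair : ∀ b c, b = p.1 ∨ c = p.1 → |express p u b - express p u c| < (W + 1 : ℕ) := by
        rintro b c (rfl | rfl)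
        · rw [express_self, zero_sub, abs_neg]; exact hlt c
        · rw [express_self, sub_zero]; exact hlt b
      refine ihk _ hwl (fun b c => ?_) ?_
      · by_cases h : b = p.1 ∨ c = p.1
        · exact (hpair b c h).le
        · push Not at h
          rw [express_sub_express h.1 h.2]
          exact hW b c
      · have hmem := mem_extremes_of_isTop hW hp hbc
        have hsub : extremes (express p u) (W + 1) ⊆ (extremes u (W + 1)).erase p.1 := by
          intro d hd
          obtain ⟨e, he⟩ := mem_extremes.1 hd
          have hde : ¬ (d = p.1 ∨ e = p.1) := fun h => (hpair d e h).ne he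
          push Not at hde
          refine Finset.mem_erase.2 ⟨hde.1, mem_extremes.2 ⟨e, ?_⟩⟩
          rwa [← express_sub_express hde.1 hde.2]
        have h1 := Finset.card_le_card hsub
        rw [Finset.card_erase_of_mem hmem] at h1
        omega

/-- A number of moves of maximal rate that leads from any list to a ladder. -/
def settleSteps (N : ℕ) : ℕ := N + (N + 1 + (N + 1) * (2 * N) + N)

/-- Whatever the list, `settleSteps N` moves of maximal rate visit a ladder. -/
theorem mem_forcedIn_ladders [NeZero N] (hN : 2 ≤ N) {u : Fin N → ℤ} (hu : u ∈ lists N) :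
    u ∈ forcedIn (ladders N) (settleSteps N) := by
  refine forcedIn_trans (mem_forcedIn_small_of_mem_lists hu) (fun v hv hvl => ?_) hu
  refine mem_forcedIn_of_spread hN (2 * N) N v hvl (fun b c => ?_) ?_
  · have h1 := hv b
    have h2 := hv c
    rw [abs_lt] at h1 h2
    rw [abs_le]
    push_cast
    omega
  · simpa using Finset.card_le_univ (extremes v (2 * N))

/-! ### Reaching a negative ladder -/

/-- The list reached from `u` when the actors `0, ..., i - 1` have expressed the opinion `-1` in
this order. -/
def lower (u : Fin N → ℤ) (i : ℕ) : Fin N → ℤ :=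
  fun b => if (b : ℕ) < i then (b : ℤ) + 1 - i else u b - i

theorem lower_zero (u : Fin N → ℤ) : lower u 0 = u := by
  funext b; simp [lower]

theorem lower_succ (u : Fin N → ℤ) {i : ℕ} (hi : i < N) :
    lower u (i + 1) = express (⟨i, hi⟩, -1) (lower u i) := by
  funext b
  simp only [lower, express, Fin.ext_iff]
  push_cast
  split_ifs <;> omega

theorem lower_mem_negLadder [NeZero N] (u : Fin N → ℤ) : lower u N ∈ negLadder N := by
  have hN : 0 < N := Nat.pos_of_ne_zero (NeZero.ne N)
  refine ⟨⟨⟨N - 1, by omega⟩, ?_⟩, ?_⟩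
  · simp only [lower]
    rw [if_pos (by omega)]
    push_cast [Nat.cast_sub (show 1 ≤ N by omega)]
    ring
  · ext k
    simp only [Set.mem_range, Set.mem_ofPred_eq]
    constructor
    · rintro ⟨b, rfl⟩
      have := b.2
      simp only [lower, if_pos this]
      omega
    · rintro ⟨h1, h2⟩
      refine ⟨⟨(k + N - 1).toNat, by omega⟩, ?_⟩
      simp only [lower]
      rw [if_pos (by omega)]
      omega

theorem lower_mem_lists {u : Fin N → ℤ} (hu : u ∈ lists N) {i : ℕ} (hi : i ≤ N) :
    lower u i ∈ lists N := by
  cases i with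
  | zero => rwa [lower_zero]
  | succ i => rw [lower_succ u hi]; exact express_mem_lists _ _

theorem abs_lower_le {u : Fin N → ℤ} {m : ℕ} (hu : ∀ b, |u b| ≤ m) (i : ℕ) (b : Fin N) :
    |lower u i b| ≤ m + i := by
  have := abs_le.1 (hu b)
  rw [abs_le]
  simp only [lower]
  split_ifs <;> omega

/-- A property of lists that holds on the negative ladders, and that passes from the outcome of some
move to the list where the move is made, holds everywhere. -/
theorem negLadder_induction [NeZero N] {Q : (Fin N → ℤ) → Prop} (hneg : ∀ u ∈ negLadder N, Q u)
    (hstep : ∀ u ∈ lists N, u ∉ negLadder N → ∀ p, Q (express p u) → Q u) {u : Fin N → ℤ}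
    (hu : u ∈ lists N) : Q u := by
  suffices ∀ j i, i + j = N → Q (lower u i) by simpa [lower_zero] using this N 0 (by omega)
  intro j
  induction j with
  | zero =>
    rintro i rfl
    exact hneg _ (lower_mem_negLadder u)
  | succ j ih =>
    intro i hi
    by_cases hl : lower u i ∈ negLadder N
    · exact hneg _ hl
    · refine hstep _ (lower_mem_lists hu (by omega)) hl (⟨i, by omega⟩, -1) ?_
      rw [← lower_succ]
      exact ih (i + 1) (by omega)

/-! ### The generator and a maximum principle -/

/-- The total rate at which opinions are expressed under the list `u`. -/
def totalRate (β : ℝ≥0) (u : Fin N → ℤ) : ℝ := ∑ p, rate β u p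

/-- The probability that the pair `p` is the next one to act under the list `u`. -/
def stepProb (β : ℝ≥0) (u : Fin N → ℤ) (p : Mark N) : ℝ := rate β u p / totalRate β u

theorem rate_pos (β : ℝ≥0) (u : Fin N → ℤ) (p : Mark N) : 0 < rate β u p := Real.exp_pos _

theorem totalRate_pos [NeZero N] (β : ℝ≥0) (u : Fin N → ℤ) : 0 < totalRate β u :=
  Finset.sum_pos (fun p _ => rate_pos β u p) Finset.univ_nonempty

theorem stepProb_pos [NeZero N] (β : ℝ≥0) (u : Fin N → ℤ) (p : Mark N) : 0 < stepProb β u p :=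
  div_pos (rate_pos β u p) (totalRate_pos β u)

theorem sum_stepProb [NeZero N] (β : ℝ≥0) (u : Fin N → ℤ) : ∑ p, stepProb β u p = 1 := by
  simp only [stepProb]
  rw [← Finset.sum_div]
  exact div_self (totalRate_pos β u).ne'

theorem totalRate_mul_stepProb [NeZero N] (β : ℝ≥0) (u : Fin N → ℤ) (p : Mark N) :
    totalRate β u * stepProb β u p = rate β u p :=
  mul_div_cancel₀ _ (totalRate_pos β u).ne'

theorem rate_le_exp (β : ℝ≥0) {u : Fin N → ℤ} {p : Mark N} {m : ℤ} (h : (p.2 : ℤ) * u p.1 ≤ m) :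
    rate β u p ≤ Real.exp (β * m) := by
  refine Real.exp_le_exp.2 ?_
  rw [mul_assoc]
  exact mul_le_mul_of_nonneg_left (by exact_mod_cast h) β.2

theorem rate_eq_exp (β : ℝ≥0) {u : Fin N → ℤ} {p : Mark N} {m : ℤ} (h : (p.2 : ℤ) * u p.1 = m) :
    rate β u p = Real.exp (β * m) := by
  rw [rate, mul_assoc, ← h]
  push_cast
  rfl

theorem exp_le_rate (β : ℝ≥0) {u : Fin N → ℤ} {p : Mark N} {m : ℤ} (h : m ≤ (p.2 : ℤ) * u p.1) :
    Real.exp (β * m) ≤ rate β u p := by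
  rw [rate_eq_exp β rfl]
  exact Real.exp_le_exp.2 (mul_le_mul_of_nonneg_left (by exact_mod_cast h) β.2)

theorem units_mul_le_abs (u : Fin N → ℤ) (p : Mark N) : (p.2 : ℤ) * u p.1 ≤ |u p.1| :=
  units_mul_self_le_abs _ _

theorem totalRate_le (β : ℝ≥0) {u : Fin N → ℤ} {m : ℤ} (h : ∀ b, |u b| ≤ m) :
    totalRate β u ≤ Fintype.card (Mark N) * Real.exp (β * m) := by
  refine (Finset.sum_le_card_nsmul _ _ _ fun p _ =>
    rate_le_exp β ((units_mul_le_abs u p).trans (h p.1))).trans_eq ?_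
  rw [Finset.card_univ, nsmul_eq_mul]

theorem card_mark_pos [NeZero N] : (0 : ℝ) < Fintype.card (Mark N) := by
  exact_mod_cast Fintype.card_pos

theorem IsTop.le_stepProb [NeZero N] (β : ℝ≥0) {u : Fin N → ℤ} {p : Mark N} (hp : IsTop u p) :
    (Fintype.card (Mark N) : ℝ)⁻¹ ≤ stepProb β u p := by
  rw [stepProb, le_div_iff₀ (totalRate_pos β u), inv_mul_le_iff₀ card_mark_pos]
  exact (totalRate_le β hp).trans_eq (by rw [← rate_eq_exp β rfl])

theorem le_stepProb [NeZero N] (β : ℝ≥0) {u : Fin N → ℤ} {m : ℤ} (h : ∀ b, |u b| ≤ m)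
    (p : Mark N) :
    Real.exp (-(2 * β * m)) / Fintype.card (Mark N) ≤ stepProb β u p := by
  rw [stepProb, div_le_div_iff₀ card_mark_pos (totalRate_pos β u)]
  have h1 : Real.exp (β * ((-m : ℤ) : ℝ)) ≤ rate β u p := by
    refine exp_le_rate β ?_
    have h1 := h p.1
    have h2 := units_mul_self_le_abs p.2 (-u p.1)
    rw [abs_neg, mul_neg] at h2
    omega
  calc Real.exp (-(2 * β * m)) * totalRate β u
      ≤ Real.exp (-(2 * β * m)) * (Fintype.card (Mark N) * Real.exp (β * m)) := by
        gcongr; exact totalRate_le β h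
    _ = Real.exp (β * ((-m : ℤ) : ℝ)) * Fintype.card (Mark N) := by
        rw [mul_left_comm, ← Real.exp_add, mul_comm]
        congr 2
        push_cast
        ring
    _ ≤ _ := by gcongr

/-- One step of the contraction: a gain `ε` at the outcome of one move, of probability at least `η`,
is a gain `η * ε` at the list where the move is made. -/
theorem le_of_subharmonic_step [NeZero N] {β : ℝ≥0} {X : (Fin N → ℤ) → ℝ} {C η ε : ℝ}
    {u : Fin N → ℤ} (hC0 : 0 ≤ C) (hC : ∀ v ∈ lists N, X v ≤ C) (hε : 0 ≤ ε)
    (hsub : X u ≤ ∑ p, stepProb β u p * X (express p u)) {p : Mark N} (hη : η ≤ stepProb β u p)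
    (hp : X (express p u) ≤ (1 - ε) * C) : X u ≤ (1 - η * ε) * C := by
  have h1 : ∑ q, stepProb β u q * (C - X (express q u)) =
      C - ∑ q, stepProb β u q * X (express q u) := by
    simp only [mul_sub, Finset.sum_sub_distrib, ← Finset.sum_mul, sum_stepProb, one_mul]
  have h2 : stepProb β u p * (C - X (express p u)) ≤
      ∑ q, stepProb β u q * (C - X (express q u)) :=
    Finset.single_le_sum (f := fun q => stepProb β u q * (C - X (express q u)))
      (fun q _ => mul_nonneg (stepProb_pos β u q).le
        (sub_nonneg.2 (hC _ (express_mem_lists q u)))) (Finset.mem_univ p)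
  have h3 : stepProb β u p * (ε * C) ≤ stepProb β u p * (C - X (express p u)) :=
    mul_le_mul_of_nonneg_left (by linarith) (stepProb_pos β u p).le
  have h4 : η * (ε * C) ≤ stepProb β u p * (ε * C) :=
    mul_le_mul_of_nonneg_right hη (mul_nonneg hε hC0)
  nlinarith

/-- The constant by which one passage to the negative ladders contracts the bound of a function that
is subharmonic off `B` and nonpositive on `B`. It is uniform, because the entries of the list can be
brought below `N` by moves of maximal rate, and from there a fixed number of moves leads to a
negative ladder. -/
theorem exists_contraction [NeZero N] (β : ℝ≥0) : ∃ ε : ℝ, 0 < ε ∧ ε ≤ 1 ∧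
    ∀ (B : Set (Fin N → ℤ)) (X : (Fin N → ℤ) → ℝ) (C : ℝ), negLadder N ⊆ B → 0 ≤ C →
      (∀ u ∈ lists N, X u ≤ C) → (∀ u ∈ lists N, u ∈ B → X u ≤ 0) →
      (∀ u ∈ lists N, u ∉ B → X u ≤ ∑ p, stepProb β u p * X (express p u)) →
      ∀ u ∈ lists N, X u ≤ (1 - ε) * C := by
  set K : ℝ := ((Fintype.card (Mark N) : ℕ) : ℝ) with hK
  have hKpos : 0 < K := card_mark_pos
  have hK1 : 1 ≤ K := by
    have : 0 < Fintype.card (Mark N) := Fintype.card_pos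
    rw [hK]
    exact_mod_cast this
  set η : ℝ := Real.exp (-(2 * β * ((2 * N : ℕ) : ℤ))) / K with hη
  have hηpos : 0 < η := by positivity
  have hη1 : η ≤ 1 := by
    rw [hη, div_le_one hKpos]
    refine le_trans (Real.exp_le_one_iff.2 ?_) hK1
    have : (0 : ℝ) ≤ 2 * β * ((2 * N : ℕ) : ℤ) := by positivity
    linarith
  have hKi : K⁻¹ ≤ 1 := inv_le_one_of_one_le₀ hK1
  refine ⟨K⁻¹ ^ N * η ^ N, by positivity, mul_le_one₀ (pow_le_one₀ (by positivity) hKi)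
    (by positivity) (pow_le_one₀ hηpos.le hη1), ?_⟩
  intro B X C hB hC0 hC hXB hsub
  have hle : ∀ u ∈ lists N, u ∈ B → ∀ ε ≤ 1, X u ≤ (1 - ε) * C := fun u hu huB ε hε =>
    (hXB u hu huB).trans (mul_nonneg (by linarith) hC0)
  have hpath : ∀ u ∈ lists N, (∀ b, |u b| < N) → ∀ j i, i + j = N →
      X (lower u i) ≤ (1 - η ^ j) * C := by
    intro u hu hsmall j
    induction j with
    | zero =>
      rintro i rfl
      exact hle _ (lower_mem_lists hu le_rfl) (hB (lower_mem_negLadder u)) _ (by simp)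
    | succ j ih =>
      intro i hi
      have hl : lower u i ∈ lists N := lower_mem_lists hu (by omega)
      by_cases hBi : lower u i ∈ B
      · exact hle _ hl hBi _ (pow_le_one₀ hηpos.le hη1)
      · rw [pow_succ']
        refine le_of_subharmonic_step hC0 hC (by positivity) (hsub _ hl hBi)
          (p := (⟨i, by omega⟩, -1)) (le_stepProb β (fun b => ?_) _) ?_
        · have := abs_lower_le (m := N) (fun b => (hsmall b).le) i b
          push_cast
          omega
        · rw [← lower_succ]
          exact ih (i + 1) (by omega)
  have hforced : ∀ n, n ≤ N → ∀ u ∈ lists N,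
      u ∈ forcedIn {v : Fin N → ℤ | ∀ b, |v b| < N} n → X u ≤ (1 - K⁻¹ ^ n * η ^ N) * C := by
    have hstart : ∀ u ∈ lists N, (∀ b, |u b| < N) → ∀ n : ℕ,
        X u ≤ (1 - K⁻¹ ^ n * η ^ N) * C := by
      intro u hu hs n
      have h := hpath u hu hs N 0 (by omega)
      rw [lower_zero] at h
      refine h.trans (mul_le_mul_of_nonneg_right ?_ hC0)
      have : K⁻¹ ^ n * η ^ N ≤ η ^ N :=
        mul_le_of_le_one_left (by positivity) (pow_le_one₀ (by positivity) hKi)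
      linarith
    intro n
    induction n with
    | zero => exact fun _ u hu hs => hstart u hu hs 0
    | succ n ih =>
      intro hn u hu hf
      rcases hf with hs | hf
      · exact hstart u hu hs _
      by_cases huB : u ∈ B
      · exact hle u hu huB _ (mul_le_one₀ (pow_le_one₀ (by positivity) hKi)
          (by positivity) (pow_le_one₀ hηpos.le hη1))
      obtain ⟨p, hp⟩ := exists_isTop u
      rw [pow_succ', mul_assoc]
      exact le_of_subharmonic_step hC0 hC (by positivity) (hsub u hu huB) (hp.le_stepProb β)
        (ih (by omega) _ (express_mem_lists p u) (hf p hp))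
  exact fun u hu => hforced N le_rfl u hu (mem_forcedIn_small_of_mem_lists hu)

/-- **Maximum principle.** A bounded function that is subharmonic for the embedded chain off a set
containing the negative ladders, and nonpositive on this set, is nonpositive. -/
theorem nonpos_of_subharmonic [NeZero N] (β : ℝ≥0) {B : Set (Fin N → ℤ)} (hB : negLadder N ⊆ B)
    {X : (Fin N → ℤ) → ℝ} {C : ℝ} (hC : ∀ u ∈ lists N, X u ≤ C)
    (hXB : ∀ u ∈ lists N, u ∈ B → X u ≤ 0)
    (hsub : ∀ u ∈ lists N, u ∉ B → X u ≤ ∑ p, stepProb β u p * X (express p u))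
    {u : Fin N → ℤ} (hu : u ∈ lists N) : X u ≤ 0 := by
  obtain ⟨ε, hε, hε1, h⟩ := exists_contraction (N := N) β
  have hC0 : 0 ≤ max C 0 := le_max_right _ _
  have key : ∀ n : ℕ, ∀ v ∈ lists N, X v ≤ (1 - ε) ^ n * max C 0 := by
    intro n
    induction n with
    | zero => exact fun v hv => by simpa using Or.inl (hC v hv)
    | succ n ih =>
      intro v hv
      rw [pow_succ', mul_assoc]
      exact h B X _ hB (mul_nonneg (pow_nonneg (by linarith) n) hC0) ih hXB hsub v hv
  refine ge_of_tendsto' (x := atTop) (f := fun n : ℕ => (1 - ε) ^ n * max C 0) ?_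
    fun n => key n u hu
  simpa using (tendsto_pow_atTop_nhds_zero_of_lt_one (by linarith : 0 ≤ 1 - ε)
    (by linarith)).mul_const (max C 0)

/-! ### Exponential variables and their minimum -/

theorem expMeasure_eq_withDensity (r : ℝ) :
    expMeasure r = volume.withDensity (exponentialPDF r) := rfl

theorem measurable_exponentialPDF (r : ℝ) : Measurable (exponentialPDF r) :=
  (measurable_exponentialPDFReal r).ennreal_ofReal

instance nullSingletonClass_expMeasure (r : ℝ) : NullSingletonClass (expMeasure r) := by
  rw [expMeasure_eq_withDensity]; infer_instance

theorem expMeasure_Iic {r : ℝ} (hr : 0 < r) (t : ℝ) :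
    expMeasure r (Set.Iic t) = ENNReal.ofReal (if 0 ≤ t then 1 - Real.exp (-(r * t)) else 0) := by
  rw [expMeasure_eq_withDensity, withDensity_apply _ measurableSet_Iic,
    lintegral_exponentialPDF_eq_antiDeriv hr]

theorem expMeasure_Ioi {r : ℝ} (hr : 0 < r) {t : ℝ} (ht : 0 ≤ t) :
    expMeasure r (Set.Ioi t) = ENNReal.ofReal (Real.exp (-(r * t))) := by
  have := isProbabilityMeasure_expMeasure hr
  rw [← Set.compl_Iic, prob_compl_eq_one_sub measurableSet_Iic, expMeasure_Iic hr, if_pos ht,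
    ← ENNReal.ofReal_one, ← ENNReal.ofReal_sub _
      (sub_nonneg.2 (Real.exp_le_one_iff.2 (by have := mul_nonneg hr.le ht; linarith)))]
  congr 1
  ring

theorem expMeasure_Ici {r : ℝ} (hr : 0 < r) {t : ℝ} (ht : 0 ≤ t) :
    expMeasure r (Set.Ici t) = ENNReal.ofReal (Real.exp (-(r * t))) := by
  rw [← expMeasure_Ioi hr ht]
  exact measure_congr Ioi_ae_eq_Ici.symm

theorem expMeasure_Iic_zero {r : ℝ} (hr : 0 < r) : expMeasure r (Set.Iic 0) = 0 := by
  rw [expMeasure_Iic hr]; simp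

theorem expMeasure_Ioo_pos {r : ℝ} (hr : 0 < r) {x y : ℝ} (hx : 0 ≤ x) (hxy : x < y) :
    0 < expMeasure r (Set.Ioo x y) := by
  rw [expMeasure_eq_withDensity, withDensity_apply _ measurableSet_Ioo,
    setLIntegral_pos_iff (measurable_exponentialPDF r)]
  refine lt_of_lt_of_le (b := volume (Set.Ioo x y)) (by simpa using hxy) (measure_mono ?_)
  intro s hs
  refine ⟨?_, hs⟩
  exact (ENNReal.ofReal_pos.2 (exponentialPDFReal_pos hr (hx.trans_lt hs.1))).ne'

theorem expMeasure_map_div {r : ℝ} (hr : 0 < r) :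
    (expMeasure 1).map (fun x => x / r) = expMeasure r := by
  have := isProbabilityMeasure_expMeasure hr
  have : IsProbabilityMeasure ((expMeasure 1).map (fun x => x / r)) :=
    Measure.isProbabilityMeasure_map (by fun_prop)
  refine Measure.ext_of_Iic _ _ fun t => ?_
  rw [Measure.map_apply (by fun_prop) measurableSet_Iic]
  have : (fun x => x / r) ⁻¹' Set.Iic t = Set.Iic (t * r) := by
    ext x; simp [div_le_iff₀ hr]
  rw [this, expMeasure_Iic one_pos, expMeasure_Iic hr, one_mul, mul_comm r t]
  simp only [mul_nonneg_iff_of_pos_right hr]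

theorem charFun_expMeasure {r : ℝ} (hr : 0 < r) (t : ℝ) :
    charFun (expMeasure r) t = r / (r - t * Complex.I) := by
  have hre : (-(r - t * Complex.I)).re < 0 := by simpa using hr
  have hne : (r - t * Complex.I : ℂ) ≠ 0 := by
    intro h; rw [h] at hre; simp at hre
  rw [charFun_apply_real, expMeasure_eq_withDensity,
    integral_withDensity_eq_integral_toReal_smul (measurable_exponentialPDF r)
      (ae_of_all _ fun _ => ENNReal.ofReal_lt_top)]
  have hint : (fun x => (exponentialPDF r x).toReal • Complex.exp (t * x * Complex.I)) =
      (Set.Ici (0 : ℝ)).indicator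
        (fun x => (r : ℂ) * Complex.exp (-(r - t * Complex.I) * x)) := by
    funext x
    by_cases hx : 0 ≤ x
    · rw [Set.indicator_of_mem (Set.mem_Ici.2 hx), exponentialPDF_of_nonneg hx,
        ENNReal.toReal_ofReal (by positivity), Complex.real_smul]
      push_cast
      rw [mul_assoc, ← Complex.exp_add]
      congr 2
      ring
    · rw [Set.indicator_of_notMem (by simpa using hx), exponentialPDF_of_neg (not_le.1 hx)]
      simp
  rw [hint, integral_indicator measurableSet_Ici, integral_Ici_eq_integral_Ioi,
    integral_const_mul, integral_exp_mul_complex_Ioi hre]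
  simp only [Complex.ofReal_zero, mul_zero, Complex.exp_zero]
  rw [neg_div_neg_eq, mul_one_div]

/-- The event that the `p`-th of several independent exponential variables is the smallest, with
value in `B`: the density `r p * exp (-r p * s)` of its value, times the probability
`exp (-∑ q ≠ p, r q * s)` that the others are larger, is `r p / Λ` times the density of the
exponential law of parameter `Λ = ∑ q, r q`. -/
theorem pi_expMeasure_min {ι : Type*} [Fintype ι] {r : ι → ℝ} (hr : ∀ i, 0 < r i) (p : ι)
    {B : Set ℝ} (hB : MeasurableSet B) :
    Measure.pi (fun i => expMeasure (r i)) {x | (∀ q, x p ≤ x q) ∧ x p ∈ B} =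
      ENNReal.ofReal (r p / ∑ i, r i) * expMeasure (∑ i, r i) B := by
  classical
  have hprob : ∀ i, IsProbabilityMeasure (expMeasure (r i)) :=
    fun i => isProbabilityMeasure_expMeasure (hr i)
  have hΛ : 0 < ∑ i, r i := Finset.sum_pos (fun i _ => hr i) ⟨p, Finset.mem_univ p⟩
  set μ : ι → Measure ℝ := fun i => expMeasure (r i) with hμ
  have hmp := measurePreserving_piEquivPiSubtypeProd μ (fun i => i = p)
  set T : Set (({i // i = p} → ℝ) × ({i // ¬ i = p} → ℝ)) :=
    {z | (∀ q, z.1 ⟨p, rfl⟩ ≤ z.2 q) ∧ z.1 ⟨p, rfl⟩ ∈ B} with hT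
  have hTm : MeasurableSet T := by
    have hTi : T = (⋂ q : {i // ¬ i = p}, {z | z.1 ⟨p, rfl⟩ ≤ z.2 q}) ∩
        (fun z => z.1 ⟨p, rfl⟩) ⁻¹' B := by
      ext z; simp [hT]
    rw [hTi]
    exact (MeasurableSet.iInter fun q => measurableSet_le (by fun_prop) (by fun_prop)).inter
      (measurableSet_preimage (by fun_prop) hB)
  have hpre : {x : ι → ℝ | (∀ q, x p ≤ x q) ∧ x p ∈ B} =
      (MeasurableEquiv.piEquivPiSubtypeProd (fun _ : ι => ℝ) (fun i => i = p)) ⁻¹' T := by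
    ext x
    simp only [hT, Set.mem_preimage, Set.mem_ofPred_eq]
    refine and_congr_left fun _ => ⟨fun h q => h q, fun h q => ?_⟩
    by_cases hq : q = p
    · rw [hq]
    · exact h ⟨q, hq⟩
  rw [hpre, hmp.measure_preimage hTm.nullMeasurableSet, Measure.prod_apply hTm]
  set g : ℝ → ℝ≥0∞ := fun s => ∏ q : {i // ¬ i = p}, μ q (Set.Ici s) with hg
  have hgm : Measurable g := by
    refine Finset.measurable_prod _ fun q _ => Antitone.measurable fun s t hst => ?_
    exact measure_mono (Set.Ici_subset_Ici.2 hst)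
  have hslice : ∀ y : {i // i = p} → ℝ,
      Measure.pi (fun i : {i // ¬ i = p} => μ i) (Prod.mk y ⁻¹' T) =
        B.indicator g (y ⟨p, rfl⟩) := by
    intro y
    by_cases hy : y ⟨p, rfl⟩ ∈ B
    · rw [Set.indicator_of_mem hy]
      refine Eq.trans ?_ (Measure.pi_pi (fun q : {i // ¬ i = p} => μ q)
        (fun _ => Set.Ici (y ⟨p, rfl⟩)))
      congr 1
      ext z
      simp [hT, hy, Pi.le_def]
    · have hempty : Prod.mk y ⁻¹' T = ∅ := by
        ext z
        simp [hT, hy]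
      rw [Set.indicator_of_notMem hy, hempty, measure_empty]
  simp only [hslice]
  let _ : Fintype {i // i = p} := Subtype.fintype _
  have hev := measurePreserving_eval (fun i : {i // i = p} => μ i) ⟨p, rfl⟩
  refine (hev.lintegral_comp (f := B.indicator g) (hgm.indicator hB)).trans ?_
  rw [lintegral_indicator hB]
  simp only [hμ]
  rw [expMeasure_eq_withDensity, expMeasure_eq_withDensity,
    setLIntegral_withDensity_eq_setLIntegral_mul _ (measurable_exponentialPDF _) hgm hB,
    withDensity_apply _ hB, ← lintegral_const_mul _ (measurable_exponentialPDF _)]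
  refine lintegral_congr fun s => ?_
  simp only [Pi.mul_apply]
  rcases lt_or_ge s 0 with hs | hs
  · simp [exponentialPDF_of_neg hs]
  · have hgs : g s = ENNReal.ofReal (Real.exp (-((∑ q : {i // ¬ i = p}, r q) * s))) := by
      simp only [hg, hμ, expMeasure_Ici (hr _) hs]
      rw [← ENNReal.ofReal_prod_of_nonneg (fun _ _ => (Real.exp_pos _).le), ← Real.exp_sum,
        Finset.sum_neg_distrib, Finset.sum_mul]
    have hsum : r p + ∑ q : {i // ¬ i = p}, r q = ∑ i, r i := by
      have h1 : ∑ q : {i // i = p}, r q = r p :=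
        Fintype.sum_unique (fun q : {i // i = p} => r q)
      rw [← Fintype.sum_subtype_add_sum_subtype (fun i => i = p) r, h1]
    rw [hgs, exponentialPDF_of_nonneg hs, exponentialPDF_of_nonneg hs,
      ← ENNReal.ofReal_mul (by have := hr p; positivity),
      ← ENNReal.ofReal_mul (by have := hr p; positivity), mul_assoc, ← Real.exp_add, ← hsum]
    congr 1
    rw [← mul_assoc, div_mul_cancel₀ _ (by rw [hsum]; exact hΛ.ne')]
    congr 2
    ring

/-! ### The law of the first jump -/

instance discreteMeasurableSpace_units_int : DiscreteMeasurableSpace ℤˣ where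
  forall_measurableSet s :=
    ⟨Units.val '' s, .of_discrete, Set.preimage_image_eq _ Units.val_injective⟩

theorem measurable_first [NeZero N] : Measurable (first : (Mark N → ℝ) → Mark N) := by
  classical
  -- `first x` depends on `x` only through the set of its minimizers
  let F : (Mark N → Prop) → Mark N := fun P =>
    if h : ∃ i, P i then Classical.choose h else Classical.arbitrary _
  have hF : (first : (Mark N → ℝ) → Mark N) = fun x => F fun i => ∀ j, x i ≤ x j := by
    funext x
    exact (dif_pos (Finite.exists_min x)).symm
  have hFm : Measurable F := measurable_of_countable F
  rw [hF]
  refine hFm.comp (measurable_pi_lambda _ fun i => ?_)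
  exact Measurable.forall fun j => measurableSet_setOfPred.1
    (measurableSet_le (measurable_pi_apply i) (measurable_pi_apply j))

theorem measurable_min_first [NeZero N] :
    Measurable fun x : Mark N → ℝ => (first x, x (first x)) := by
  refine measurable_first.prodMk ?_
  have h : Measurable fun z : (Mark N → ℝ) × Mark N => z.1 z.2 :=
    measurable_from_prod_countable_left fun p => measurable_pi_apply p
  exact h.comp (measurable_id.prodMk measurable_first)

/-- The law of the next pair to act under the list `u`. -/
def markLaw (β : ℝ≥0) (u : Fin N → ℤ) : Measure (Mark N) :=
  ∑ p, ENNReal.ofReal (stepProb β u p) • Measure.dirac p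

instance isProbabilityMeasure_markLaw [NeZero N] (β : ℝ≥0) (u : Fin N → ℤ) :
    IsProbabilityMeasure (markLaw β u) where
  measure_univ := by
    simp only [markLaw, Measure.coe_finsetSum, Finset.sum_apply, Measure.smul_apply,
      measure_univ, smul_eq_mul, mul_one]
    rw [← ENNReal.ofReal_sum_of_nonneg fun p _ => (stepProb_pos β u p).le, sum_stepProb,
      ENNReal.ofReal_one]

/-- Among independent exponential variables, the index of the smallest one and its value are
independent. One inequality between the two laws comes from `pi_expMeasure_min`, and it is an
equality because both have mass one; ties need no separate treatment. -/
theorem map_first_min [NeZero N] (β : ℝ≥0) (u : Fin N → ℤ) :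
    (Measure.pi fun p => expMeasure (rate β u p)).map (fun x => (first x, x (first x))) =
      (markLaw β u).prod (expMeasure (totalRate β u)) := by
  have hprob : ∀ p, IsProbabilityMeasure (expMeasure (rate β u p)) :=
    fun p => isProbabilityMeasure_expMeasure (rate_pos β u p)
  have := isProbabilityMeasure_expMeasure (totalRate_pos β u)
  have := Measure.isProbabilityMeasure_map
    (μ := Measure.pi fun p => expMeasure (rate β u p)) measurable_min_first.aemeasurable
  refine Measure.eq_of_le_of_isProbabilityMeasure (Measure.le_iff.2 fun S hS => ?_)
  rw [Measure.map_apply measurable_min_first hS]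
  have hcover : (fun x : Mark N → ℝ => (first x, x (first x))) ⁻¹' S ⊆
      ⋃ p, {x | (∀ q, x p ≤ x q) ∧ x p ∈ Prod.mk p ⁻¹' S} := by
    intro x hx
    exact Set.mem_iUnion.2 ⟨first x, first_le x, hx⟩
  refine (measure_mono hcover).trans ((measure_iUnion_le _).trans_eq ?_)
  rw [tsum_fintype, Measure.prod_apply hS, markLaw, lintegral_finsetSum_measure]
  refine Finset.sum_congr rfl fun p _ => ?_
  rw [pi_expMeasure_min (rate_pos β u) p (measurable_prodMk_left hS), lintegral_smul_measure,
    lintegral_dirac]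
  rfl

theorem measurable_clock (β : ℝ≥0) (u : Fin N → ℤ) : Measurable (clock β u) := by
  unfold clock; fun_prop

theorem map_clock [NeZero N] (β : ℝ≥0) (u : Fin N → ℤ) :
    (Measure.pi fun _ : Mark N => expMeasure 1).map (clock β u) =
      Measure.pi fun p => expMeasure (rate β u p) := by
  have hprob : ∀ p, IsProbabilityMeasure ((expMeasure 1).map fun x => x / rate β u p) :=
    fun p => Measure.isProbabilityMeasure_map (by fun_prop)
  have h := Measure.pi_map_pi (μ := fun _ : Mark N => expMeasure 1)
    (f := fun p x => x / rate β u p) (fun p => by fun_prop)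
  simp only [expMeasure_map_div (rate_pos β u _)] at h
  exact h

/-- Removing the first step from a sample point. -/
def shift (ω : Sample N) : Sample N := fun n => ω (n + 1)

theorem measurable_shift : Measurable (shift : Sample N → Sample N) :=
  measurable_pi_lambda _ fun n => measurable_pi_apply (n + 1)

theorem map_split_prob :
    (prob N).map (fun ω => (ω 0, shift ω)) =
      (Measure.pi fun _ : Mark N => expMeasure 1).prod (prob N) := by
  classical
  let E : Measure (Mark N → ℝ) := Measure.pi fun _ : Mark N => expMeasure 1
  let cons : (Mark N → ℝ) × Sample N → Sample N := fun z n => Nat.casesOn n z.1 z.2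
  have hcons : Measurable cons := by
    refine measurable_pi_lambda _ fun n => ?_
    cases n with
    | zero => exact measurable_fst
    | succ n => exact (measurable_pi_apply n).comp measurable_snd
  have hsplit : Measurable fun ω : Sample N => (ω 0, shift ω) :=
    (measurable_pi_apply 0).prodMk measurable_shift
  have key : (E.prod (prob N)).map cons = prob N := by
    refine Measure.eq_infinitePi _ fun s t ht => ?_
    let t' : ℕ → Set (Mark N → ℝ) := fun i => if i ∈ s then t i else Set.univ
    have ht' : ∀ i, MeasurableSet (t' i) := fun i => by
      by_cases hi : i ∈ s <;> simp [t', hi, ht]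
    obtain ⟨n, hn⟩ : ∃ n, s ⊆ Finset.range (n + 1) :=
      ⟨s.sup id, fun i hi => Finset.mem_range.2 (Nat.lt_succ_of_le (Finset.le_sup (f := id) hi))⟩
    have h1 : Set.pi (s : Set ℕ) t = Set.pi (Finset.range (n + 1) : Set ℕ) t' := by
      ext ω
      simp only [Set.mem_pi, Finset.mem_coe]
      refine ⟨fun h i _ => ?_, fun h i hi => by simpa [t', hi] using h i (hn hi)⟩
      by_cases hi : i ∈ s <;> simp [t', hi, h]
    have h2 : cons ⁻¹' Set.pi (Finset.range (n + 1) : Set ℕ) t' =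
        t' 0 ×ˢ Set.pi (Finset.range n : Set ℕ) fun i => t' (i + 1) := by
      ext z
      simp only [Set.mem_preimage, Set.mem_pi, Finset.mem_coe, Finset.mem_range, Set.mem_prod]
      refine ⟨fun h => ⟨h 0 (by omega), fun i hi => h (i + 1) (by omega)⟩, ?_⟩
      rintro ⟨h0, h⟩ (_ | i) hi
      · exact h0
      · exact h i (by omega)
    rw [h1, Measure.map_apply hcons
      (MeasurableSet.pi (Finset.countable_toSet _) fun i _ => ht' i), h2, Measure.prod_prod, prob,
      Measure.infinitePi_pi _ (fun i _ => ht' (i + 1)), mul_comm,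
      ← Finset.prod_range_succ' (fun i => E (t' i)) n]
    refine (Finset.prod_subset hn fun i _ hi => ?_).symm.trans
      (Finset.prod_congr rfl fun i hi => ?_)
    · simp [t', hi, E]
    · simp [t', hi, E]
  conv_lhs => rw [← key]
  rw [Measure.map_map hsplit hcons]
  exact Measure.map_id

/-- The first jump and what follows: under the law `prob N`, the pair which acts first, the time
at which it acts, and the shifted sample point are independent. -/
theorem map_jump_prob [NeZero N] (β : ℝ≥0) (u : Fin N → ℤ) :
    (prob N).map (fun ω => ((first (clock β u (ω 0)), clock β u (ω 0) (first (clock β u (ω 0)))),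
      shift ω)) =
      ((markLaw β u).prod (expMeasure (totalRate β u))).prod (prob N) := by
  have := isProbabilityMeasure_expMeasure (totalRate_pos β u)
  have hm : Measurable fun ξ : Mark N → ℝ => (first (clock β u ξ), clock β u ξ
      (first (clock β u ξ))) := measurable_min_first.comp (measurable_clock β u)
  have h1 : (Measure.pi fun _ : Mark N => expMeasure 1).map
      (fun ξ => (first (clock β u ξ), clock β u ξ (first (clock β u ξ)))) =
      (markLaw β u).prod (expMeasure (totalRate β u)) := by
    rw [← map_first_min, ← map_clock, Measure.map_map measurable_min_first (measurable_clock β u)]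
    rfl
  have h2 := Measure.map_prod_map (Measure.pi fun _ : Mark N => expMeasure 1) (prob N) hm
    measurable_id
  rw [h1, Measure.map_id, ← map_split_prob, Measure.map_map (hm.prodMap measurable_id)
    ((measurable_pi_apply 0).prodMk measurable_shift)] at h2
  exact h2.symm

/-! ### Hitting times along the jumps -/

/-- The law of a function of the first jump and of the shifted sample point, as a mixture over the
pair which acts first. -/
theorem prob_map_jump [NeZero N] {α : Type*} [MeasurableSpace α] (β : ℝ≥0) (u : Fin N → ℤ)
    {G : (Mark N × ℝ) × Sample N → α} (hG : Measurable G) :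
    (prob N).map (fun ω => G ((first (clock β u (ω 0)),
      clock β u (ω 0) (first (clock β u (ω 0)))), shift ω)) =
      ∑ p, ENNReal.ofReal (stepProb β u p) •
        ((expMeasure (totalRate β u)).prod (prob N)).map fun z => G ((p, z.1), z.2) := by
  have := isProbabilityMeasure_expMeasure (totalRate_pos β u)
  have hm : Measurable fun ω : Sample N => ((first (clock β u (ω 0)),
      clock β u (ω 0) (first (clock β u (ω 0)))), shift ω) :=
    ((measurable_min_first.comp (measurable_clock β u)).comp
      (measurable_pi_apply 0)).prodMk measurable_shift
  rw [show (fun ω : Sample N => G ((first (clock β u (ω 0)),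
      clock β u (ω 0) (first (clock β u (ω 0)))), shift ω)) = G ∘ fun ω : Sample N =>
      ((first (clock β u (ω 0)), clock β u (ω 0) (first (clock β u (ω 0)))), shift ω) from rfl,
    ← Measure.map_map hG hm, map_jump_prob]
  ext S hS
  have hGS := hG hS
  rw [Measure.map_apply hG hS, Measure.prod_apply hGS,
    lintegral_prod _ (measurable_measure_prodMk_left hGS).aemeasurable, markLaw,
    lintegral_finsetSum_measure, Measure.coe_finsetSum, Finset.sum_apply]
  refine Finset.sum_congr rfl fun p _ => ?_
  have hp : Measurable fun z : ℝ × Sample N => G ((p, z.1), z.2) := by fun_prop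
  rw [lintegral_smul_measure, lintegral_dirac, Measure.smul_apply, Measure.map_apply hp hS,
    Measure.prod_apply (hp hS)]
  rfl

theorem chain_succ_eq [NeZero N] (β : ℝ≥0) (u : Fin N → ℤ) (ω : Sample N) (n : ℕ) :
    chain β u ω (n + 1) = chain β (express (first (clock β u (ω 0))) u) (shift ω) n := by
  induction n with
  | zero => rfl
  | succ n ih =>
    rw [chain, ih]
    rfl

theorem jumpTime_succ_eq [NeZero N] (β : ℝ≥0) (u : Fin N → ℤ) (ω : Sample N) (n : ℕ) :
    jumpTime β u ω (n + 1) = clock β u (ω 0) (first (clock β u (ω 0))) +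
      jumpTime β (express (first (clock β u (ω 0))) u) (shift ω) n := by
  induction n with
  | zero => simp [jumpTime, chain]
  | succ n ih =>
    rw [jumpTime, ih, chain_succ_eq, add_assoc]
    rfl

theorem measurable_chain [NeZero N] (β : ℝ≥0) (u : Fin N → ℤ) (n : ℕ) :
    Measurable fun ω => chain β u ω n := by
  induction n with
  | zero => exact measurable_const
  | succ n ih =>
    have h : Measurable fun z : (Fin N → ℤ) × (Mark N → ℝ) =>
        express (first (clock β z.1 z.2)) z.1 :=
      measurable_from_prod_countable_right fun v =>
        (measurable_of_countable fun p => express p v).comp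
          (measurable_first.comp (measurable_clock β v))
    exact h.comp (ih.prodMk (measurable_pi_apply n))

theorem measurable_jumpTime [NeZero N] (β : ℝ≥0) (u : Fin N → ℤ) (n : ℕ) :
    Measurable fun ω => jumpTime β u ω n := by
  induction n with
  | zero => exact measurable_const
  | succ n ih =>
    have h : Measurable fun z : (Fin N → ℤ) × (Mark N → ℝ) =>
        clock β z.1 z.2 (first (clock β z.1 z.2)) :=
      measurable_from_prod_countable_right fun v =>
        (measurable_snd.comp measurable_min_first).comp (measurable_clock β v)
    exact ih.add (h.comp ((measurable_chain β u n).prodMk (measurable_pi_apply n)))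

theorem ae_pos_sample (N : ℕ) : ∀ᵐ ω ∂prob N, ∀ n p, 0 < ω n p := by
  rw [ae_all_iff]
  intro n
  have h1 : ∀ᵐ ξ ∂Measure.pi fun _ : Mark N => expMeasure 1, ∀ p, 0 < ξ p := by
    rw [ae_all_iff]
    intro p
    have h0 : ∀ᵐ x ∂expMeasure 1, 0 < x := by
      rw [ae_iff]
      simpa [Set.Iic] using expMeasure_Iic_zero one_pos
    exact (measurePreserving_eval (fun _ : Mark N => expMeasure 1)
      p).quasiMeasurePreserving.ae h0
  exact (measurePreserving_eval_infinitePi (fun _ : ℕ => Measure.pi fun _ : Mark N =>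
    expMeasure 1) n).quasiMeasurePreserving.ae h1

theorem clock_pos {β : ℝ≥0} {u : Fin N → ℤ} {ξ : Mark N → ℝ} (hξ : ∀ p, 0 < ξ p) (p : Mark N) :
    0 < clock β u ξ p := div_pos (hξ p) (rate_pos β u p)

theorem strictMono_jumpTime [NeZero N] (β : ℝ≥0) (u : Fin N → ℤ) {ω : Sample N}
    (hω : ∀ n p, 0 < ω n p) : StrictMono (jumpTime β u ω) :=
  strictMono_nat_of_lt_succ fun n => lt_add_of_pos_right _ (clock_pos (hω n) _)

theorem jumpTime_nonneg [NeZero N] (β : ℝ≥0) (u : Fin N → ℤ) {ω : Sample N}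
    (hω : ∀ n p, 0 < ω n p) (n : ℕ) : 0 ≤ jumpTime β u ω n :=
  (strictMono_jumpTime β u hω).monotone (Nat.zero_le n)

open Classical in
/-- The first jump time at which the embedded chain is in `B`, the time `0` included. -/
def hitTime [NeZero N] (β : ℝ≥0) (B : Set (Fin N → ℤ)) (u : Fin N → ℤ) (ω : Sample N) : ℝ≥0∞ :=
  ⨅ n, if chain β u ω n ∈ B then ENNReal.ofReal (jumpTime β u ω n) else ⊤

theorem measurable_hitTime [NeZero N] (β : ℝ≥0) (B : Set (Fin N → ℤ)) (u : Fin N → ℤ) :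
    Measurable (hitTime β B u) := by
  classical
  unfold hitTime
  refine Measurable.iInf fun n => Measurable.ite ?_
    (measurable_jumpTime β u n).ennreal_ofReal measurable_const
  exact measurable_chain β u n B.to_countable.measurableSet

theorem hitTime_of_mem [NeZero N] (β : ℝ≥0) {B : Set (Fin N → ℤ)} {u : Fin N → ℤ} (hu : u ∈ B)
    (ω : Sample N) : hitTime β B u ω = 0 := by
  refine le_antisymm ((iInf_le _ 0).trans ?_) zero_le
  simp [chain, jumpTime, hu]

theorem hitTime_of_notMem [NeZero N] (β : ℝ≥0) {B : Set (Fin N → ℤ)} {u : Fin N → ℤ}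
    (hu : u ∉ B) {ω : Sample N} (hω : ∀ n p, 0 < ω n p) :
    hitTime β B u ω = ENNReal.ofReal (clock β u (ω 0) (first (clock β u (ω 0)))) +
      hitTime β B (express (first (clock β u (ω 0))) u) (shift ω) := by
  classical
  rw [hitTime, hitTime, ENNReal.add_iInf, ← inf_iInf_nat_succ]
  rw [show chain β u ω 0 = u from rfl, if_neg hu, top_inf_eq]
  refine iInf_congr fun n => ?_
  rw [chain_succ_eq]
  split_ifs
  · have hω' : ∀ k p, 0 < shift ω k p := fun k => hω (k + 1)
    rw [jumpTime_succ_eq, ENNReal.ofReal_add (clock_pos (hω 0) _).le (jumpTime_nonneg _ _ hω' n)]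
  · simp

/-- When the exponential times are positive, the reaching time is the hitting time along the jumps.
Explosion of the jump times need not be excluded: a hitting time precedes it, and after it the junk
value of `pressure` is a list visited by the chain. -/
theorem reachTime_eq_hitTime [NeZero N] (β : ℝ≥0) {B : Set (Fin N → ℤ)} {u : Fin N → ℤ}
    (hu : u ∉ B) {ω : Sample N} (hω : ∀ n p, 0 < ω n p) :
    reachTime β u B ω = hitTime β B u ω := by
  classical
  have hT := strictMono_jumpTime β u hω
  by_cases hex : ∃ n, chain β u ω n ∈ B
  · have hn := Nat.find_spec hex
    have hmin : ∀ m, m < Nat.find hex → chain β u ω m ∉ B := fun m => Nat.find_min hex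
    set n := Nat.find hex
    have hn0 : 0 < n := by
      rcases Nat.eq_zero_or_pos n with h | h
      · rw [h] at hn; exact absurd hn hu
      · exact h
    have h1 : hitTime β B u ω = ENNReal.ofReal (jumpTime β u ω n) := by
      refine le_antisymm ((iInf_le _ n).trans (by rw [if_pos hn])) (le_iInf fun k => ?_)
      split_ifs with hk
      · refine ENNReal.ofReal_le_ofReal (hT.monotone ?_)
        by_contra hlt
        exact hmin k (not_le.1 hlt) hk
      · exact le_top
    rw [h1]
    refine le_antisymm (sInf_le ⟨jumpTime β u ω n, ⟨hT hn0, ?_⟩, rfl⟩) (le_sInf ?_)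
    · rw [pressure_eq β u ω hT.monotone le_rfl (hT (Nat.lt_succ_self n))]
      exact hn
    · rintro _ ⟨t, ⟨ht, htB⟩, rfl⟩
      refine ENNReal.ofReal_le_ofReal (not_lt.1 fun hlt => ?_)
      have hbd : ∀ k ∈ {m : ℕ | jumpTime β u ω m ≤ t}, k < n := fun k hk =>
        hT.lt_iff_lt.1 (lt_of_le_of_lt hk hlt)
      have hmem : sSup {m : ℕ | jumpTime β u ω m ≤ t} ∈ {m : ℕ | jumpTime β u ω m ≤ t} :=
        Nat.sSup_mem ⟨0, ht.le⟩ ⟨n, fun k hk => (hbd k hk).le⟩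
      exact hmin _ (hbd _ hmem) htB
  · push Not at hex
    have h1 : hitTime β B u ω = ⊤ := by simp [hitTime, hex]
    have h2 : {t : ℝ | 0 < t ∧ pressure β u ω t ∈ B} = ∅ := by
      ext t
      simp [pressure, hex]
    rw [h1, reachTime, h2, Set.image_empty, sInf_empty]

theorem ae_hitTime_eq [NeZero N] (β : ℝ≥0) {B : Set (Fin N → ℤ)} {u : Fin N → ℤ} (hu : u ∉ B) :
    hitTime β B u =ᵐ[prob N] fun ω =>
      ENNReal.ofReal (clock β u (ω 0) (first (clock β u (ω 0)))) +
        hitTime β B (express (first (clock β u (ω 0))) u) (shift ω) := by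
  filter_upwards [ae_pos_sample N] with ω hω using hitTime_of_notMem β hu hω

theorem measurable_hitTime_express [NeZero N] (β : ℝ≥0) (B : Set (Fin N → ℤ)) (u : Fin N → ℤ) :
    Measurable fun z : (Mark N × ℝ) × Sample N => hitTime β B (express z.1.1 u) z.2 := by
  have h : Measurable fun y : Mark N × Sample N => hitTime β B (express y.1 u) y.2 :=
    measurable_from_prod_countable_right fun p => measurable_hitTime β B (express p u)
  exact h.comp ((measurable_fst.comp measurable_fst).prodMk measurable_snd)

/-- The set `B` is hit almost surely: the probability of never hitting it is harmonic off `B`, so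
the maximum principle applies. -/
theorem ae_hitTime_lt_top [NeZero N] (β : ℝ≥0) {B : Set (Fin N → ℤ)} (hB : negLadder N ⊆ B)
    {u : Fin N → ℤ} (hu : u ∈ lists N) : ∀ᵐ ω ∂prob N, hitTime β B u ω < ⊤ := by
  set g : (Fin N → ℤ) → ℝ := fun u => (prob N).real {ω | hitTime β B u ω = ⊤} with hg
  have h0 : g u ≤ 0 := by
    refine nonpos_of_subharmonic β hB (X := g) (C := 1) (fun u _ => measureReal_le_one) ?_ ?_ hu
    · intro u _ huB
      simp [hg, hitTime_of_mem β huB]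
    · intro u _ huB
      have := isProbabilityMeasure_expMeasure (totalRate_pos β u)
      have hG : Measurable fun z : (Mark N × ℝ) × Sample N =>
          ENNReal.ofReal z.1.2 + hitTime β B (express z.1.1 u) z.2 :=
        (measurable_snd.comp measurable_fst).ennreal_ofReal.add
          (measurable_hitTime_express β B u)
      have h1 : (prob N).map (hitTime β B u) {⊤} = ∑ p, ENNReal.ofReal (stepProb β u p) *
          prob N {ω | hitTime β B (express p u) ω = ⊤} := by
        rw [Measure.map_congr (ae_hitTime_eq β huB), prob_map_jump β u hG, Measure.coe_finsetSum,
          Finset.sum_apply]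
        refine Finset.sum_congr rfl fun p _ => ?_
        have hp : Measurable fun z : ℝ × Sample N =>
            ENNReal.ofReal z.1 + hitTime β B (express p u) z.2 :=
          measurable_fst.ennreal_ofReal.add ((measurable_hitTime β B _).comp measurable_snd)
        rw [Measure.smul_apply, Measure.map_apply hp (measurableSet_singleton _), smul_eq_mul]
        congr 1
        have : (fun z : ℝ × Sample N => ENNReal.ofReal z.1 + hitTime β B (express p u) z.2) ⁻¹'
            {⊤} = Set.univ ×ˢ {ω | hitTime β B (express p u) ω = ⊤} := by
          ext z; simp
        rw [this, Measure.prod_prod, measure_univ, one_mul]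
      rw [Measure.map_apply (measurable_hitTime β B u) (measurableSet_singleton _)] at h1
      refine le_of_eq ?_
      simp only [hg, measureReal_def]
      refine (congrArg ENNReal.toReal h1).trans ?_
      rw [ENNReal.toReal_sum fun p _ => ENNReal.mul_ne_top ENNReal.ofReal_ne_top
        (measure_ne_top _ _)]
      exact Finset.sum_congr rfl fun p _ => by
        rw [ENNReal.toReal_mul, ENNReal.toReal_ofReal (stepProb_pos β u p).le]
  have h1 : (prob N) {ω | hitTime β B u ω = ⊤} = 0 :=
    (measureReal_eq_zero_iff).1 (le_antisymm h0 measureReal_nonneg)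
  rw [ae_iff]
  simpa using h1

/-! ### The law of the hitting time of the negative ladders -/

/-- The law of the hitting time of the negative ladders, from the list `u`, as a measure on `ℝ`. The
value `∞`, which `toReal` sends to `0`, has probability zero when `u` is in `lists N`. -/
def hitLaw [NeZero N] (β : ℝ≥0) (u : Fin N → ℤ) : Measure ℝ :=
  (prob N).map fun ω => (hitTime β (negLadder N) u ω).toReal

theorem measurable_toReal_hitTime [NeZero N] (β : ℝ≥0) (B : Set (Fin N → ℤ)) (u : Fin N → ℤ) :
    Measurable fun ω => (hitTime β B u ω).toReal :=
  (measurable_hitTime β B u).ennreal_toReal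

instance isProbabilityMeasure_hitLaw [NeZero N] (β : ℝ≥0) (u : Fin N → ℤ) :
    IsProbabilityMeasure (hitLaw β u) :=
  Measure.isProbabilityMeasure_map (measurable_toReal_hitTime β _ u).aemeasurable

theorem hitLaw_of_mem [NeZero N] (β : ℝ≥0) {u : Fin N → ℤ} (hu : u ∈ negLadder N) :
    hitLaw β u = Measure.dirac 0 := by
  simp [hitLaw, hitTime_of_mem β hu]

/-- First-step decomposition of the law of the hitting time. -/
theorem hitLaw_eq_sum [NeZero N] (β : ℝ≥0) {u : Fin N → ℤ} (hu : u ∉ negLadder N) :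
    hitLaw β u = ∑ p, ENNReal.ofReal (stepProb β u p) •
      (expMeasure (totalRate β u) ∗ hitLaw β (express p u)) := by
  have := isProbabilityMeasure_expMeasure (totalRate_pos β u)
  have hG : Measurable fun z : (Mark N × ℝ) × Sample N =>
      z.1.2 + (hitTime β (negLadder N) (express z.1.1 u) z.2).toReal :=
    (measurable_snd.comp measurable_fst).add (measurable_hitTime_express β _ u).ennreal_toReal
  have hfin : ∀ᵐ ω ∂prob N, ∀ p, hitTime β (negLadder N) (express p u) (shift ω) < ⊤ := by
    rw [ae_all_iff]
    intro p
    have hmp : MeasurePreserving (shift : Sample N → Sample N) (prob N) (prob N) := by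
      refine ⟨measurable_shift, ?_⟩
      have h := congrArg (Measure.map Prod.snd) (map_split_prob (N := N))
      rw [Measure.map_map measurable_snd ((measurable_pi_apply 0).prodMk measurable_shift),
        Measure.map_snd_prod, measure_univ, one_smul] at h
      exact h
    exact hmp.quasiMeasurePreserving.ae (ae_hitTime_lt_top β subset_rfl (express_mem_lists p u))
  have hae : (fun ω => (hitTime β (negLadder N) u ω).toReal) =ᵐ[prob N] fun ω =>
      clock β u (ω 0) (first (clock β u (ω 0))) +
        (hitTime β (negLadder N) (express (first (clock β u (ω 0))) u) (shift ω)).toReal := by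
    filter_upwards [ae_pos_sample N, ae_hitTime_eq β hu, hfin] with ω hω h1 h2
    rw [h1, ENNReal.toReal_add ENNReal.ofReal_ne_top (h2 _).ne,
      ENNReal.toReal_ofReal (clock_pos (hω 0) _).le]
  rw [hitLaw, Measure.map_congr hae, prob_map_jump β u hG]
  refine Finset.sum_congr rfl fun p _ => ?_
  congr 1
  rw [hitLaw, Measure.conv]
  have h3 := Measure.map_prod_map (expMeasure (totalRate β u)) (prob N) measurable_id
    (measurable_toReal_hitTime β (negLadder N) (express p u))
  rw [Measure.map_id] at h3
  rw [h3, Measure.map_map (by fun_prop)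
    (measurable_id.prodMap (measurable_toReal_hitTime β _ _))]
  rfl

theorem charFun_sum_smul {ι : Type*} (s : Finset ι) (c : ι → ℝ≥0∞) (hc : ∀ i, c i ≠ ⊤)
    (μ : ι → Measure ℝ) [∀ i, IsProbabilityMeasure (μ i)] (t : ℝ) :
    charFun (∑ i ∈ s, c i • μ i) t = ∑ i ∈ s, ((c i).toReal : ℂ) * charFun (μ i) t := by
  simp only [charFun_apply_real]
  rw [integral_finsetSum_measure]
  · refine Finset.sum_congr rfl fun i _ => ?_
    rw [integral_smul_measure, Complex.real_smul]
  · intro i _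
    refine Integrable.smul_measure ?_ (hc i)
    refine (integrable_const (1 : ℝ)).mono (by fun_prop) (ae_of_all _ fun x => ?_)
    rw [show (t * x * Complex.I : ℂ) = ((t * x : ℝ) : ℂ) * Complex.I by push_cast; rfl,
      Complex.norm_exp_ofReal_mul_I]
    simp

theorem sub_mul_I_ne_zero {r : ℝ} (hr : 0 < r) (t : ℝ) : (r - t * Complex.I : ℂ) ≠ 0 := by
  intro h
  have := congrArg Complex.re h
  simp at this
  exact hr.ne' this

theorem le_norm_sub_mul_I {r : ℝ} (hr : 0 < r) (t : ℝ) : r ≤ ‖(r - t * Complex.I : ℂ)‖ := by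
  have := Complex.abs_re_le_norm (r - t * Complex.I : ℂ)
  simp only [Complex.sub_re, Complex.ofReal_re, Complex.mul_re, Complex.I_re, mul_zero,
    Complex.ofReal_im, Complex.I_im, mul_one, sub_self, sub_zero, abs_of_pos hr] at this
  exact this

/-- The characteristic function of the hitting time, as a function of the starting list, solves the
resolvent equation of the generator off the negative ladders. -/
theorem resolvent_charFun_hitLaw [NeZero N] (β : ℝ≥0) {u : Fin N → ℤ} (hu : u ∉ negLadder N)
    (t : ℝ) : (totalRate β u - t * Complex.I) * charFun (hitLaw β u) t =
      ∑ p, (rate β u p : ℂ) * charFun (hitLaw β (express p u)) t := by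
  have := isProbabilityMeasure_expMeasure (totalRate_pos β u)
  have hne := sub_mul_I_ne_zero (totalRate_pos β u) t
  rw [hitLaw_eq_sum β hu, charFun_sum_smul _ _ (fun p => ENNReal.ofReal_ne_top), Finset.mul_sum]
  refine Finset.sum_congr rfl fun p _ => ?_
  rw [ENNReal.toReal_ofReal (stepProb_pos β u p).le, charFun_conv,
    charFun_expMeasure (totalRate_pos β u), ← totalRate_mul_stepProb]
  push_cast
  field_simp

theorem hitLaw_conv_apply [NeZero N] {r : ℝ} (hr : 0 < r) (β : ℝ≥0) (w : Fin N → ℤ) {S : Set ℝ}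
    (hS : MeasurableSet S) : (expMeasure r ∗ hitLaw β w) S =
      ∫⁻ y, expMeasure r {x | x + y ∈ S} ∂hitLaw β w := by
  have := isProbabilityMeasure_expMeasure hr
  rw [Measure.conv, Measure.map_apply (by fun_prop) hS,
    Measure.prod_apply_symm (measurableSet_preimage (by fun_prop) hS)]
  rfl

theorem hitLaw_apply [NeZero N] (β : ℝ≥0) {u : Fin N → ℤ} (hu : u ∉ negLadder N) {S : Set ℝ}
    (hS : MeasurableSet S) : hitLaw β u S = ∑ p, ENNReal.ofReal (stepProb β u p) *
      ∫⁻ y, expMeasure (totalRate β u) {x | x + y ∈ S} ∂hitLaw β (express p u) := by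
  rw [hitLaw_eq_sum β hu, Measure.coe_finsetSum, Finset.sum_apply]
  simp only [Measure.smul_apply, smul_eq_mul, hitLaw_conv_apply (totalRate_pos β u) β _ hS]

theorem hitLaw_singleton [NeZero N] (β : ℝ≥0) {u : Fin N → ℤ} (hu : u ∉ negLadder N) (t : ℝ) :
    hitLaw β u {t} = 0 := by
  rw [hitLaw_apply β hu (measurableSet_singleton t)]
  refine Finset.sum_eq_zero fun p _ => ?_
  have : ∀ y : ℝ, {x | x + y ∈ ({t} : Set ℝ)} = {t - y} := by
    intro y; ext x; simp [eq_sub_iff_add_eq]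
  simp only [this, measure_singleton, lintegral_zero, mul_zero]

theorem hitLaw_Iio_zero [NeZero N] (β : ℝ≥0) (u : Fin N → ℤ) : hitLaw β u (Set.Iio 0) = 0 := by
  rw [hitLaw, Measure.map_apply (measurable_toReal_hitTime β _ u) measurableSet_Iio]
  convert! measure_empty (μ := prob N)
  ext ω
  simp

/-- The first jump time has a positive density, so if the remaining time can be arbitrarily small,
the hitting time can fall in any interval of positive reals. -/
theorem hitLaw_Ioo_pos_of_step [NeZero N] (β : ℝ≥0) {u : Fin N → ℤ} (hu : u ∉ negLadder N)
    {p : Mark N} (hp : ∀ y > 0, 0 < hitLaw β (express p u) (Set.Iio y)) {x y : ℝ} (hxy : x < y)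
    (hy : 0 < y) : 0 < hitLaw β u (Set.Ioo x y) := by
  have hΛ := totalRate_pos β u
  have := isProbabilityMeasure_expMeasure hΛ
  rw [hitLaw_apply β hu measurableSet_Ioo]
  refine lt_of_lt_of_le ?_ (Finset.single_le_sum (fun _ _ => zero_le) (Finset.mem_univ p))
  refine ENNReal.mul_pos (ENNReal.ofReal_pos.2 (stepProb_pos β u p)).ne' (ne_of_gt ?_)
  have hset : ∀ z : ℝ, {s | s + z ∈ Set.Ioo x y} = Set.Ioo (x - z) (y - z) := by
    intro z; ext s; simp [sub_lt_iff_lt_add, lt_sub_iff_add_lt]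
  have hm : Measurable fun z => expMeasure (totalRate β u) {s | s + z ∈ Set.Ioo x y} := by
    have : MeasurableSet {q : ℝ × ℝ | q.1 + q.2 ∈ Set.Ioo x y} :=
      measurableSet_preimage (f := fun q : ℝ × ℝ => q.1 + q.2) (by fun_prop) measurableSet_Ioo
    exact measurable_measure_prodMk_right this
  rw [lintegral_pos_iff_support hm]
  refine (hp y hy).trans_le (measure_mono fun z hz => ?_)
  have hz' : z < y := hz
  rw [Function.mem_support, hset]
  refine ne_of_gt (lt_of_lt_of_le (expMeasure_Ioo_pos hΛ (x := max (x - z) 0) (y := y - z)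
    (le_max_right _ _) (max_lt (by linarith) (by linarith))) (measure_mono ?_))
  exact Set.Ioo_subset_Ioo_left (le_max_left _ _)

theorem hitLaw_Iio_pos [NeZero N] (β : ℝ≥0) {u : Fin N → ℤ} (hu : u ∈ lists N) :
    ∀ y > 0, 0 < hitLaw β u (Set.Iio y) := by
  refine negLadder_induction (Q := fun u => ∀ y > 0, 0 < hitLaw β u (Set.Iio y)) ?_ ?_ hu
  · intro u hu y hy
    rw [hitLaw_of_mem β hu, Measure.dirac_apply' _ measurableSet_Iio]
    simp [hy]
  · intro u _ hu p hp y hy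
    exact (hitLaw_Ioo_pos_of_step β hu hp (sub_one_lt y) hy).trans_le
      (measure_mono Set.Ioo_subset_Iio_self)

theorem hitLaw_Ioo_pos [NeZero N] (β : ℝ≥0) {u : Fin N → ℤ} (hu : u ∉ negLadder N) {x y : ℝ}
    (hxy : x < y) (hy : 0 < y) : 0 < hitLaw β u (Set.Ioo x y) :=
  hitLaw_Ioo_pos_of_step β hu (p := Classical.arbitrary _)
    (hitLaw_Iio_pos β (express_mem_lists _ u)) hxy hy

theorem continuous_cdf (μ : Measure ℝ) [IsProbabilityMeasure μ] (h : ∀ t, μ {t} = 0) :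
    Continuous (cdf μ) := by
  refine continuous_iff_continuousAt.2 fun t => ?_
  rw [(monotone_cdf μ).continuousAt_iff_leftLim_eq_rightLim, StieltjesFunction.rightLim_eq]
  have h1 := (cdf μ).measure_singleton t
  rw [measure_cdf, h t] at h1
  exact le_antisymm ((monotone_cdf μ).leftLim_le le_rfl)
    (sub_nonpos.1 (ENNReal.ofReal_eq_zero.1 h1.symm))

/-- The law of the hitting time has a unique quantile of each order in `(0, 1)`. -/
theorem exists_quantile_hitLaw [NeZero N] (β : ℝ≥0) {u : Fin N → ℤ} (hu : u ∉ negLadder N)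
    {q : ℝ} (hq0 : 0 < q) (hq1 : q < 1) :
    ∃ c : ℝ, 0 < c ∧ ∀ x : ℝ, 0 < x → (hitLaw β u (Set.Ioi x) = ENNReal.ofReal q ↔ x = c) := by
  have hcont := continuous_cdf (hitLaw β u) (hitLaw_singleton β hu)
  have htail : ∀ x, hitLaw β u (Set.Ioi x) = ENNReal.ofReal (1 - cdf (hitLaw β u) x) := by
    intro x
    rw [← Set.compl_Iic, prob_compl_eq_one_sub measurableSet_Iic, ← ofReal_cdf,
      ENNReal.ofReal_sub _ (cdf_nonneg _ _), ENNReal.ofReal_one]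
  have hiff : ∀ x, hitLaw β u (Set.Ioi x) = ENNReal.ofReal q ↔ cdf (hitLaw β u) x = 1 - q := by
    intro x
    rw [htail, ENNReal.ofReal_eq_ofReal_iff (sub_nonneg.2 (cdf_le_one _ _)) hq0.le]
    constructor <;> intro h <;> linarith
  have hlt : ∀ x y, x < y → 0 < y → cdf (hitLaw β u) x < cdf (hitLaw β u) y := by
    intro x y hxy hy
    rw [cdf_eq_real, cdf_eq_real, ← Set.Iic_union_Ioc_eq_Iic hxy.le,
      measureReal_union (Set.Iic_disjoint_Ioc le_rfl) measurableSet_Ioc]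
    refine lt_add_of_pos_right _ (ENNReal.toReal_pos (ne_of_gt ?_) (measure_ne_top _ _))
    exact (hitLaw_Ioo_pos β hu hxy hy).trans_le (measure_mono Set.Ioo_subset_Ioc_self)
  have hzero : cdf (hitLaw β u) 0 = 0 := by
    rw [cdf_eq_real, measureReal_def, ← Set.Iio_union_right, measure_union_null
      (hitLaw_Iio_zero β u) (hitLaw_singleton β hu 0), ENNReal.toReal_zero]
  obtain ⟨y, hy⟩ := ((tendsto_cdf_atTop (hitLaw β u)).eventually
    (lt_mem_nhds (show 1 - q < 1 by linarith))).exists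
  obtain ⟨c, hc⟩ := mem_range_of_exists_le_of_exists_ge (c := 1 - q) hcont
    ⟨0, by rw [hzero]; linarith⟩ ⟨y, hy.le⟩
  have hc0 : 0 < c := by
    by_contra hneg
    have := monotone_cdf (hitLaw β u) (not_lt.1 hneg)
    rw [hc, hzero] at this
    linarith
  refine ⟨c, hc0, fun x hx => ?_⟩
  rw [hiff]
  refine ⟨fun h => ?_, fun h => by rw [h, hc]⟩
  rcases lt_trichotomy x c with hxc | hxc | hxc
  · have := hlt x c hxc hc0
    linarith
  · exact hxc
  · have := hlt c x hxc hx
    linarith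

/-! ### Exchanging the actors -/

theorem express_comp_perm (σ : Equiv.Perm (Fin N)) (a : Fin N) (o : ℤˣ) (u : Fin N → ℤ) :
    express (a, o) (u ∘ σ) = express (σ a, o) u ∘ σ := by
  funext b
  simp [express]

theorem negLadder_comp_perm (σ : Equiv.Perm (Fin N)) {u : Fin N → ℤ} :
    u ∘ σ ∈ negLadder N ↔ u ∈ negLadder N := by
  simp only [negLadder, lists, Set.mem_ofPred_eq, EquivLike.range_comp]
  refine and_congr_left fun _ => ⟨fun ⟨a, ha⟩ => ⟨σ a, ha⟩, fun ⟨a, ha⟩ => ⟨σ.symm a, ?_⟩⟩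
  simpa using ha

theorem sum_rate_comp_perm {M : Type*} [AddCommMonoid M] [Module ℝ M] (β : ℝ≥0)
    (σ : Equiv.Perm (Fin N)) (u : Fin N → ℤ) (f : (Fin N → ℤ) → M) :
    ∑ p, rate β (u ∘ σ) p • f (express p (u ∘ σ)) =
      ∑ p, rate β u p • f (express p u ∘ σ) := by
  refine Fintype.sum_equiv (σ.prodCongr (Equiv.refl _)) _ _ fun p => ?_
  obtain ⟨a, o⟩ := p
  simp only [Equiv.prodCongr_apply, Prod.map, Equiv.refl_apply, express_comp_perm]
  rfl

theorem totalRate_comp_perm (β : ℝ≥0) (σ : Equiv.Perm (Fin N)) (u : Fin N → ℤ) :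
    totalRate β (u ∘ σ) = totalRate β u := by
  have := sum_rate_comp_perm β σ u fun _ => (1 : ℝ)
  simpa [totalRate] using this

/-- The law of the hitting time is invariant under a permutation of the actors: the difference of
the two characteristic functions solves the same linear equation with null boundary values. -/
theorem hitLaw_comp_perm [NeZero N] (β : ℝ≥0) (σ : Equiv.Perm (Fin N)) {u : Fin N → ℤ}
    (hu : u ∈ lists N) : hitLaw β (u ∘ σ) = hitLaw β u := by
  refine Measure.ext_of_charFun (funext fun t => ?_)
  set X : (Fin N → ℤ) → ℝ :=
    fun u => ‖charFun (hitLaw β (u ∘ σ)) t - charFun (hitLaw β u) t‖ with hX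
  suffices X u ≤ 0 from sub_eq_zero.1 (norm_le_zero_iff.1 this)
  refine nonpos_of_subharmonic β subset_rfl (X := X) (C := 1 + 1) ?_ ?_ ?_ hu
  · exact fun v _ => (norm_sub_le _ _).trans
      (add_le_add (norm_charFun_le_one _) (norm_charFun_le_one _))
  · intro v _ hv
    simp [hX, hitLaw_of_mem β hv, hitLaw_of_mem β ((negLadder_comp_perm σ).2 hv)]
  · intro v _ hv
    have hΛ := totalRate_pos β v
    have h1 := resolvent_charFun_hitLaw β hv t
    have h2 := resolvent_charFun_hitLaw β (mt (negLadder_comp_perm σ).1 hv) t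
    have h3 := sum_rate_comp_perm β σ v fun w => charFun (hitLaw β w) t
    simp only [Complex.real_smul] at h3
    rw [h3, totalRate_comp_perm] at h2
    have h4 : (totalRate β v - t * Complex.I) *
        (charFun (hitLaw β (v ∘ σ)) t - charFun (hitLaw β v) t) =
        ∑ p, (rate β v p : ℂ) * (charFun (hitLaw β (express p v ∘ σ)) t -
          charFun (hitLaw β (express p v)) t) := by
      rw [mul_sub, h1, h2, ← Finset.sum_sub_distrib]
      simp only [mul_sub]
    have h5 : totalRate β v * X v ≤ ∑ p, rate β v p * X (express p v) := by
      refine (mul_le_mul_of_nonneg_right (le_norm_sub_mul_I hΛ t) (norm_nonneg _)).trans ?_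
      rw [← norm_mul, h4]
      refine (norm_sum_le _ _).trans_eq (Finset.sum_congr rfl fun p _ => ?_)
      rw [norm_mul, Complex.norm_real, Real.norm_of_nonneg (rate_pos β v p).le]
    simp only [stepProb, div_mul_eq_mul_div]
    rw [← Finset.sum_div, le_div_iff₀ hΛ, mul_comm]
    exact h5

theorem injective_of_range_eq {u : Fin N → ℤ}
    (hu : Set.range u = {k : ℤ | 0 ≤ k ∧ k ≤ (N : ℤ) - 1}) : Function.Injective u := by
  have h1 : Finset.univ.image u = Finset.Icc (0 : ℤ) (N - 1) := by
    rw [← Finset.coe_inj, Finset.coe_image, Finset.coe_univ, Set.image_univ, hu]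
    ext k
    simp
  have h2 : (Finset.univ.image u).card = (Finset.univ : Finset (Fin N)).card := by
    rw [h1]; simp
  have h3 := Finset.card_image_iff.1 h2
  rwa [Finset.coe_univ, Set.injOn_univ] at h3

theorem exists_perm_of_mem_posLadder {l l' : Fin N → ℤ} (hl : l ∈ posLadder N)
    (hl' : l' ∈ posLadder N) : ∃ σ : Equiv.Perm (Fin N), l' = l ∘ σ := by
  have hi := injective_of_range_eq hl.2
  have hi' := injective_of_range_eq hl'.2
  have hr : Set.range l' = Set.range l := hl'.2.trans hl.2.symm
  refine ⟨(Equiv.ofInjective l' hi').trans ((Equiv.setCongr hr).trans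
    (Equiv.ofInjective l hi).symm), funext fun b => ?_⟩
  exact (Equiv.apply_ofInjective_symm hi
    (Equiv.setCongr hr (Equiv.ofInjective l' hi' b))).symm

theorem hitLaw_eq_of_mem_posLadder [NeZero N] (β : ℝ≥0) {l l' : Fin N → ℤ}
    (hl : l ∈ posLadder N) (hl' : l' ∈ posLadder N) : hitLaw β l' = hitLaw β l := by
  obtain ⟨σ, rfl⟩ := exists_perm_of_mem_posLadder hl hl'
  exact hitLaw_comp_perm β σ hl.1

theorem notMem_negLadder_of_mem_posLadder (hN : 2 ≤ N) {l : Fin N → ℤ} (hl : l ∈ posLadder N) :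
    l ∉ negLadder N := by
  intro h
  have h1 : (1 : ℤ) ∈ {k : ℤ | 0 ≤ k ∧ k ≤ (N : ℤ) - 1} := ⟨by omega, by omega⟩
  rw [← hl.2, h.2] at h1
  have := h1.2
  omega

/-! ### A Lyapunov function for the return to the ladders -/

/-- The number of moves of maximal rate needed to reach a ladder. -/
def rank (u : Fin N → ℤ) : ℕ := sInf {n | u ∈ forcedIn (ladders N) n}

theorem mem_forcedIn_rank [NeZero N] (hN : 2 ≤ N) {u : Fin N → ℤ} (hu : u ∈ lists N) :
    u ∈ forcedIn (ladders N) (rank u) :=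
  Nat.sInf_mem (s := {n | u ∈ forcedIn (ladders N) n}) ⟨_, mem_forcedIn_ladders hN hu⟩

theorem rank_le [NeZero N] (hN : 2 ≤ N) {u : Fin N → ℤ} (hu : u ∈ lists N) :
    rank u ≤ settleSteps N :=
  Nat.sInf_le (mem_forcedIn_ladders hN hu)

theorem rank_eq_zero {u : Fin N → ℤ} (hu : u ∈ ladders N) : rank u = 0 :=
  Nat.le_zero.1 (Nat.sInf_le (s := {n | u ∈ forcedIn (ladders N) n}) hu)

theorem rank_express_add_one_le [NeZero N] (hN : 2 ≤ N) {u : Fin N → ℤ} (hu : u ∈ lists N)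
    (hL : u ∉ ladders N) {p : Mark N} (hp : IsTop u p) : rank (express p u) + 1 ≤ rank u := by
  have h := mem_forcedIn_rank hN hu
  generalize rank u = n at h ⊢
  cases n with
  | zero => exact absurd h hL
  | succ n =>
    have h' := h.resolve_left hL p hp
    exact Nat.succ_le_succ (Nat.sInf_le h')

/-- The lists of constant sign without repetition. The moves with the opinion of their sign stay in
this set, where the largest pressure is at least `N - 1`, with equality on the ladders only. -/
def orderly (N : ℕ) : Set (Fin N → ℤ) :=
  {u | Function.Injective u ∧ ∃ s : ℤˣ, ∀ b, 0 ≤ (s : ℤ) * u b}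

theorem units_mul_left_injective (s : ℤˣ) : Function.Injective fun k : ℤ => (s : ℤ) * k :=
  fun _ _ h => (Units.mul_right_inj s).1 h

theorem express_mem_orderly {s : ℤˣ} {u : Fin N → ℤ} (hi : Function.Injective u)
    (hs : ∀ b, 0 ≤ (s : ℤ) * u b) (a : Fin N) : express (a, s) u ∈ orderly N := by
  have hval := fun b => units_mul_express_of_eq s a b u
  refine ⟨fun b c hbc => ?_, s, fun b => ?_⟩
  · have h := congrArg (fun k => (s : ℤ) * k) hbc
    simp only [hval] at h
    have hb := hs b
    have hc := hs c
    split_ifs at h with h1 h2 h2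
    · rw [h1, h2]
    · omega
    · omega
    · exact hi (units_mul_left_injective s (by simpa using h))
  · rw [hval]
    split_ifs
    · exact le_rfl
    · have := hs b
      omega

theorem zero_notMem_orderly (hN : 2 ≤ N) : (0 : Fin N → ℤ) ∉ orderly N := by
  rintro ⟨h, -⟩
  have : Nontrivial (Fin N) := Fin.nontrivial_iff_two_le.2 hN
  obtain ⟨b, c, hbc⟩ := exists_pair_ne (Fin N)
  exact hbc (h rfl)

theorem ladders_subset_orderly : ladders N ⊆ orderly N := by
  intro u hu
  obtain ⟨-, s, hs⟩ := mem_ladders_iff.1 hu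
  refine ⟨fun b c hbc => injective_of_range_eq hs (by simp only [hbc]), s, fun b => ?_⟩
  have : (s : ℤ) * u b ∈ {k : ℤ | 0 ≤ k ∧ k ≤ (N : ℤ) - 1} := hs ▸ Set.mem_range_self b
  exact this.1

/-- An orderly list with entries below `N` is a ladder. -/
theorem mem_ladders_of_orderly {s : ℤˣ} {u : Fin N → ℤ} (hl : u ∈ lists N)
    (hi : Function.Injective u) (hs : ∀ b, 0 ≤ (s : ℤ) * u b)
    (hlt : ∀ b, (s : ℤ) * u b ≤ (N : ℤ) - 1) : u ∈ ladders N := by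
  refine mem_ladders_iff.2 ⟨hl, s, ?_⟩
  have hinj : Function.Injective fun b => (s : ℤ) * u b := (units_mul_left_injective s).comp hi
  have h1 : Finset.univ.image (fun b => (s : ℤ) * u b) = Finset.Icc (0 : ℤ) (N - 1) := by
    refine Finset.eq_of_subset_of_card_le (fun k hk => ?_) ?_
    · obtain ⟨b, -, rfl⟩ := Finset.mem_image.1 hk
      exact Finset.mem_Icc.2 ⟨hs b, hlt b⟩
    · rw [Finset.card_image_of_injective _ hinj]
      simp
  rw [← Set.image_univ, ← Finset.coe_univ, ← Finset.coe_image, h1]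
  ext k
  simp

theorem partialLadder_of_mem_posLadder {l : Fin N → ℤ} (hl : l ∈ posLadder N) {k : ℕ}
    (hk : k ≤ N) : PartialLadder 1 k l := by
  have hi := injective_of_range_eq hl.2
  refine ⟨fun b => ?_, fun j hj => ?_⟩
  · have : l b ∈ {k : ℤ | 0 ≤ k ∧ k ≤ (N : ℤ) - 1} := hl.2 ▸ Set.mem_range_self b
    simpa using this.1
  · have : (j : ℤ) ∈ Set.range l := by
      rw [hl.2]
      exact ⟨by omega, by omega⟩
    obtain ⟨b, hb⟩ := this
    exact ⟨b, by simpa using hb, fun c hc => hi (by rw [hb]; simpa using hc)⟩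

theorem express_mem_ladders_of_isTop [NeZero N] (hN : 2 ≤ N) {l : Fin N → ℤ}
    (hl : l ∈ posLadder N) {p : Mark N} (hp : IsTop l p) : express p l ∈ ladders N := by
  have h := (partialLadder_of_mem_posLadder hl (Nat.sub_le N 1)).express (by omega) (by omega) hp
  rw [Nat.sub_add_cancel (by omega)] at h
  obtain ⟨h1, h2⟩ := h.mem_ladder
  exact mem_ladders_iff.2 ⟨h1, 1, h2⟩

/-- The number of (actor, opinion) pairs, as a real number. -/
def numMarks (N : ℕ) : ℝ := (Fintype.card (Mark N) : ℕ)

/-- The constant in front of the Lyapunov function. -/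
def lyapConst (N : ℕ) : ℝ := 4 * numMarks N + 2

open Classical in
/-- The Lyapunov function: the number of moves of maximal rate needed to reach a ladder, weighted by
the time scale of such a move, which is `exp (-β N)` on the orderly lists and `exp (-β)` on the
others; the null list, whose rates are all one, has a weight of order one. -/
def lyap (β : ℝ≥0) (u : Fin N → ℤ) : ℝ :=
  (if u ∈ orderly N then lyapConst N * Real.exp (-(β * N)) * rank u
    else lyapConst N * Real.exp (-β) * rank u) + if u = 0 then 1 else 0

theorem lyapConst_pos : 0 < lyapConst N := by
  unfold lyapConst numMarks; positivity

theorem lyap_nonneg (β : ℝ≥0) (u : Fin N → ℤ) : 0 ≤ lyap β u := by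
  have := lyapConst_pos (N := N)
  unfold lyap
  split_ifs <;> positivity

theorem lyap_of_mem_orderly (hN : 2 ≤ N) (β : ℝ≥0) {u : Fin N → ℤ} (hu : u ∈ orderly N) :
    lyap β u = lyapConst N * Real.exp (-(β * N)) * rank u := by
  have : u ≠ 0 := fun h => zero_notMem_orderly hN (h ▸ hu)
  simp [lyap, hu, this]

theorem lyap_of_mem_ladders (hN : 2 ≤ N) (β : ℝ≥0) {u : Fin N → ℤ} (hu : u ∈ ladders N) :
    lyap β u = 0 := by
  rw [lyap_of_mem_orderly hN β (ladders_subset_orderly hu), rank_eq_zero hu]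
  simp

theorem lyap_le_of_ne_zero (hN : 2 ≤ N) (β : ℝ≥0) {u : Fin N → ℤ} (hu : u ≠ 0) :
    lyap β u ≤ lyapConst N * Real.exp (-β) * rank u := by
  have := lyapConst_pos (N := N)
  have h1 : Real.exp (-(β * N)) ≤ Real.exp (-β) := by
    refine Real.exp_le_exp.2 (neg_le_neg (le_mul_of_one_le_right β.2 ?_))
    exact_mod_cast (by omega : 1 ≤ N)
  rw [lyap, if_neg hu, add_zero]
  split_ifs
  · gcongr
  · exact le_rfl

theorem lyap_le (hN : 2 ≤ N) [NeZero N] (β : ℝ≥0) {u : Fin N → ℤ} (hu : u ∈ lists N) :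
    lyap β u ≤ lyapConst N * settleSteps N * Real.exp (-β) + if u = 0 then 1 else 0 := by
  have hA := lyapConst_pos (N := N)
  have hr : (rank u : ℝ) ≤ settleSteps N := by exact_mod_cast rank_le hN hu
  have h2 : lyapConst N * Real.exp (-β) * rank u ≤ lyapConst N * settleSteps N * Real.exp (-β) := by
    rw [mul_right_comm]
    gcongr
  by_cases h0 : u = 0
  · have : u ∉ orderly N := fun h => zero_notMem_orderly hN (h0 ▸ h)
    rw [lyap, if_neg this]
    gcongr
  · rw [if_neg h0, add_zero]
    exact (lyap_le_of_ne_zero hN β h0).trans h2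

theorem numMarks_ge_two [NeZero N] : 2 ≤ numMarks N := by
  have h : 2 ≤ Fintype.card (Mark N) := by
    have h1 : 0 < N := Nat.pos_of_ne_zero (NeZero.ne N)
    rw [Fintype.card_prod, Fintype.card_fin, Fintype.card_units_int]
    omega
  unfold numMarks
  exact_mod_cast h

theorem sum_le_of_le {f : Mark N → ℝ} {c : ℝ} (hc : 0 ≤ c) (hf : ∀ p, f p ≤ c) (p₀ : Mark N) :
    ∑ p, f p ≤ f p₀ + numMarks N * c := by
  classical
  rw [← Finset.add_sum_erase _ f (Finset.mem_univ p₀)]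
  gcongr
  refine (Finset.sum_le_card_nsmul _ _ c fun p _ => hf p).trans ?_
  rw [nsmul_eq_mul]
  refine mul_le_mul_of_nonneg_right ?_ hc
  unfold numMarks
  exact_mod_cast (Finset.card_le_card (Finset.erase_subset _ _)).trans Finset.card_univ.le

theorem rate_le_of_not_isTop (β : ℝ≥0) {u : Fin N → ℤ} {p₀ p : Mark N} (h₀ : IsTop u p₀)
    (hp : ¬ IsTop u p) :
    rate β u p ≤ Real.exp (-β) * Real.exp (β * ((p₀.2 : ℤ) * u p₀.1 : ℤ)) := by
  have h : (p.2 : ℤ) * u p.1 ≤ (p₀.2 : ℤ) * u p₀.1 - 1 := by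
    by_contra hlt
    exact hp fun b => (h₀ b).trans (by omega)
  refine (rate_le_exp β h).trans_eq ?_
  rw [← Real.exp_add]
  congr 1
  push_cast
  ring

/-- The gain `A * y` from a move of maximal rate outweighs the losses from all other moves. -/
theorem drift_le_neg_one {M K x y : ℝ} (hM : 2 ≤ M) (hK : 0 ≤ K) (hx0 : 0 ≤ x) (hy : 1 ≤ y)
    (hx : (4 * M + 2) * K * x ≤ 1 / 2) :
    -((4 * M + 2) * y) + M * ((4 * M + 2) * K * x * y + 2) ≤ -1 := by
  have hKx : 0 ≤ K * x := mul_nonneg hK hx0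
  have h1 : M * (K * x) ≤ 1 / 8 := by nlinarith
  have h2 : M * ((4 * M + 2) * K * x * y) ≤ (4 * M + 2) * y * (1 / 8) := by
    have : M * ((4 * M + 2) * K * x * y) = (4 * M + 2) * y * (M * (K * x)) := by ring
    rw [this]
    exact mul_le_mul_of_nonneg_left h1 (by positivity)
  nlinarith

/-- The list `0` is reached only by moves of rate one. -/
theorem rate_eq_one_of_express_eq_zero (β : ℝ≥0) {u : Fin N → ℤ} (hl : u ∈ lists N) {p : Mark N}
    (h : express p u = 0) : rate β u p = 1 := by
  obtain ⟨z, hz⟩ := hl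
  have hzp : z = p.1 := by
    by_contra hne
    have := congrFun h z
    rw [express_eq_of_ne hne, hz] at this
    simp at this
  rw [rate, ← hzp, hz]
  simp

/-- Off the ladders, the generator decreases `lyap` at rate at least one. On the orderly lists the
maximal rate is at least `exp (β N)`, elsewhere it is at least `exp β` (except at the null list), so
that a move of maximal rate contributes a decrease of order one or more. The moves that are
not of maximal rate are slower by a factor `exp (-β)`. -/
theorem lyap_drift [NeZero N] (hN : 3 ≤ N) {β : ℝ≥0}
    (hβ : lyapConst N * settleSteps N * Real.exp (-β) ≤ 1 / 2) {u : Fin N → ℤ}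
    (hl : u ∈ lists N) (hL : u ∉ ladders N) :
    ∑ p, rate β u p * (lyap β (express p u) - lyap β u) ≤ -1 := by
  have hN2 : 2 ≤ N := by omega
  have hA := lyapConst_pos (N := N)
  have hM := numMarks_ge_two (N := N)
  set K : ℝ := (settleSteps N : ℝ) with hK
  set A := lyapConst N with hAdef
  set x := Real.exp (-β) with hx
  have hK0 : 0 ≤ K := by positivity
  have hx0 : 0 < x := Real.exp_pos _
  have hwl := fun p => express_mem_lists p u
  have hV : ∀ p, lyap β (express p u) ≤ A * K * x + if express p u = 0 then 1 else 0 :=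
    fun p => lyap_le hN2 β (hwl p)
  by_cases hu0 : u = 0
  · -- from the null list every move has rate one and leads to a nonzero list
    have hrate : ∀ p, rate β u p = 1 := fun p => by simp [rate, hu0]
    have hw0 : ∀ p, express p u ≠ 0 := by
      intro p
      have : Nontrivial (Fin N) := Fin.nontrivial_iff_two_le.2 hN2
      obtain ⟨b, hb⟩ := exists_ne p.1
      refine Function.ne_iff.2 ⟨b, ?_⟩
      simp [express_eq_of_ne hb, hu0]
    have hVu : 1 ≤ lyap β u := by
      have : u ∉ orderly N := fun h => zero_notMem_orderly hN2 (hu0 ▸ h)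
      rw [lyap, if_neg this, if_pos hu0]
      have : 0 ≤ lyapConst N * Real.exp (-β) * rank u := by positivity
      linarith
    have hterm : ∀ p, rate β u p * (lyap β (express p u) - lyap β u) ≤ -(1 / 2) := by
      intro p
      have := hV p
      rw [if_neg (hw0 p)] at this
      rw [hrate]
      linarith
    refine (Finset.sum_le_card_nsmul _ _ _ fun p _ => hterm p).trans ?_
    rw [nsmul_eq_mul, Finset.card_univ]
    change numMarks N * _ ≤ _
    linarith
  obtain ⟨p₀, hp₀⟩ := exists_isTop u
  set m : ℤ := (p₀.2 : ℤ) * u p₀.1 with hm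
  have hrank' : ∀ p, IsTop u p → (rank (express p u) : ℝ) ≤ rank u - 1 := fun p hp => by
    have : (rank (express p u) : ℝ) + 1 ≤ rank u := by
      exact_mod_cast rank_express_add_one_le hN2 hl hL hp
    linarith
  have hm1 : 1 ≤ m := by
    obtain ⟨c, hc⟩ := Function.ne_iff.1 hu0
    have h1 : 0 < |u c| := abs_pos.2 hc
    have h2 := hp₀ c
    omega
  have hVu0 := lyap_nonneg β u
  have hr₀ : rate β u p₀ = Real.exp (β * m) := rate_eq_exp β rfl
  by_cases hD : u ∈ orderly N
  · -- on an orderly list the maximal rate is at least `exp (β N)`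
    obtain ⟨hi, s, hs⟩ := hD
    have hos : p₀.2 = s := units_eq_of_mul_pos (hs p₀.1) (by omega)
    have hmN : (N : ℤ) ≤ m := by
      by_contra hlt
      refine hL (mem_ladders_of_orderly hl hi hs fun b => ?_)
      have := hp₀ b
      have := units_mul_self_le_abs s (u b)
      omega
    set y := Real.exp (-(β * N)) * Real.exp (β * m) with hy
    have hy1 : 1 ≤ y := by
      rw [hy, ← Real.exp_add]
      refine Real.one_le_exp ?_
      have h1 : (N : ℝ) ≤ m := by exact_mod_cast hmN
      have h2 := mul_le_mul_of_nonneg_left h1 β.coe_nonneg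
      linarith
    have hVD : lyap β u = A * Real.exp (-(β * N)) * rank u := lyap_of_mem_orderly hN2 β ⟨hi, s, hs⟩
    have hVs : ∀ p : Mark N, p.2 = s →
        lyap β (express p u) = A * Real.exp (-(β * N)) * rank (express p u) := by
      rintro ⟨a, o⟩ rfl
      exact lyap_of_mem_orderly hN2 β (express_mem_orderly hi hs a)
    have hgain : ∀ p, IsTop u p → p.2 = s →
        lyap β (express p u) - lyap β u ≤ -(A * Real.exp (-(β * N))) := by
      intro p hp hps
      rw [hVs p hps, hVD, ← mul_sub]
      have : (rank (express p u) : ℝ) - rank u ≤ -1 := by linarith [hrank' p hp]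
      have h2 := mul_le_mul_of_nonneg_left this
        (show 0 ≤ A * Real.exp (-(β * N)) by positivity)
      linarith
    have hf₀ : rate β u p₀ * (lyap β (express p₀ u) - lyap β u) ≤ -(A * y) := by
      have := mul_le_mul_of_nonneg_left (hgain p₀ hp₀ hos) (rate_pos β u p₀).le
      rw [hr₀] at this ⊢
      refine this.trans_eq ?_
      rw [hy]
      ring
    have hc : 0 ≤ A * K * x * y + 2 := by positivity
    have hf : ∀ p, rate β u p * (lyap β (express p u) - lyap β u) ≤ A * K * x * y + 2 := by
      intro p
      by_cases hps : p.2 = s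
      · by_cases hp : IsTop u p
        · have h1 : lyap β (express p u) - lyap β u ≤ 0 :=
            (hgain p hp hps).trans (neg_nonpos.2 (by positivity))
          exact (mul_nonpos_of_nonneg_of_nonpos (rate_pos β u p).le h1).trans hc
        · have hrp : (rank (express p u) : ℝ) ≤ K := Nat.cast_le.2 (rank_le hN2 (hwl p))
          have h1 : lyap β (express p u) - lyap β u ≤ A * Real.exp (-(β * N)) * K := by
            rw [hVs p hps]
            have : A * Real.exp (-(β * N)) * rank (express p u) ≤
                A * Real.exp (-(β * N)) * K := by gcongr
            linarith
          have h2 := rate_le_of_not_isTop β hp₀ hp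
          have h3 : rate β u p * (lyap β (express p u) - lyap β u) ≤
              (x * Real.exp (β * m)) * (A * Real.exp (-(β * N)) * K) :=
            (mul_le_mul_of_nonneg_left h1 (rate_pos β u p).le).trans
              (mul_le_mul_of_nonneg_right h2 (by positivity))
          have h4 : (x * Real.exp (β * m)) * (A * Real.exp (-(β * N)) * K) = A * K * x * y := by
            rw [hy]; ring
          linarith
      · -- moves with the opposite opinion have rate at most one
        have hneg : p.2 = -s := by
          rcases Int.units_eq_one_or p.2 with h | h <;>
            rcases Int.units_eq_one_or s with h' | h' <;> simp_all
        have hr1 : rate β u p ≤ 1 := by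
          have h1 : (p.2 : ℤ) * u p.1 ≤ 0 := by
            rw [hneg]
            have := hs p.1
            push_cast
            linarith
          exact (rate_le_exp β h1).trans_eq (by simp)
        have h1 : lyap β (express p u) - lyap β u ≤ 2 := by
          have h2 := hV p
          have h3 : (if express p u = 0 then (1 : ℝ) else 0) ≤ 1 := by split_ifs <;> norm_num
          linarith
        have h3 : rate β u p * (lyap β (express p u) - lyap β u) ≤ 1 * 2 :=
          (mul_le_mul_of_nonneg_left h1 (rate_pos β u p).le).trans
            (mul_le_mul_of_nonneg_right hr1 (by norm_num))
        have : 0 ≤ A * K * x * y := by positivity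
        linarith
    refine (sum_le_of_le hc hf p₀).trans ((add_le_add_left hf₀ _).trans ?_)
    exact drift_le_neg_one hM hK0 hx0.le hy1 hβ
  · set y := x * Real.exp (β * m) with hy
    have hy1 : 1 ≤ y := by
      rw [hy, hx, ← Real.exp_add]
      refine Real.one_le_exp ?_
      have h1 : (1 : ℝ) ≤ m := by exact_mod_cast hm1
      have h2 := mul_le_mul_of_nonneg_left h1 β.coe_nonneg
      linarith
    have hVD : lyap β u = A * x * rank u := by simp [lyap, hD, hu0, hx, hAdef]
    have hgain : ∀ p, IsTop u p → lyap β (express p u) - lyap β u ≤ -(A * x) := by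
      intro p hp
      have h1 := lyap_le_of_ne_zero hN2 β (express_ne_zero_of_isTop hl hu0 hp)
      have h2 : A * x * rank (express p u) ≤ A * x * (rank u - 1) :=
        mul_le_mul_of_nonneg_left (hrank' p hp) (by positivity)
      rw [hVD]
      linarith
    have hf₀ : rate β u p₀ * (lyap β (express p₀ u) - lyap β u) ≤ -(A * y) := by
      have := mul_le_mul_of_nonneg_left (hgain p₀ hp₀) (rate_pos β u p₀).le
      rw [hr₀] at this ⊢
      refine this.trans_eq ?_
      rw [hy]
      ring
    have hc : 0 ≤ A * K * x * y + 2 := by positivity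
    have hf : ∀ p, rate β u p * (lyap β (express p u) - lyap β u) ≤ A * K * x * y + 2 := by
      intro p
      by_cases hp : IsTop u p
      · have h1 : lyap β (express p u) - lyap β u ≤ 0 :=
          (hgain p hp).trans (neg_nonpos.2 (by positivity))
        exact (mul_nonpos_of_nonneg_of_nonpos (rate_pos β u p).le h1).trans hc
      · have h2 := rate_le_of_not_isTop β hp₀ hp
        have h3 : rate β u p * (if express p u = 0 then (1 : ℝ) else 0) ≤ 1 := by
          split_ifs with h
          · rw [rate_eq_one_of_express_eq_zero β hl h, one_mul]
          · simp
        have h4 : rate β u p * (lyap β (express p u) - lyap β u) ≤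
            rate β u p * (A * K * x) + rate β u p * (if express p u = 0 then (1 : ℝ) else 0) := by
          rw [← mul_add]
          exact mul_le_mul_of_nonneg_left (by linarith [hV p]) (rate_pos β u p).le
        have h5 : rate β u p * (A * K * x) ≤ y * (A * K * x) :=
          mul_le_mul_of_nonneg_right h2 (by positivity)
        linarith
    refine (sum_le_of_le hc hf p₀).trans ((add_le_add_left hf₀ _).trans ?_)
    exact drift_le_neg_one hM hK0 hx0.le hy1 hβ

/-- At a positive ladder, the moves with opinion `+1` that leave the ladders have rate at most
`exp (β (N - 1) - β)` and lead to orderly lists, where `lyap` is of order `exp (-β N)`; those with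
opinion `-1` have rate at most one and lead to nonzero lists, where it is of order `exp (-β)`. -/
theorem lyap_bound_at_posLadder [NeZero N] (hN : 3 ≤ N) (β : ℝ≥0) {l : Fin N → ℤ}
    (hl : l ∈ posLadder N) : ∑ p, rate β l p * lyap β (express p l) ≤
      numMarks N * (lyapConst N * settleSteps N * Real.exp (-β)) := by
  have hN2 : 2 ≤ N := by omega
  have hA := lyapConst_pos (N := N)
  have hi := injective_of_range_eq hl.2
  have hmem : ∀ b, 0 ≤ l b ∧ l b ≤ (N : ℤ) - 1 := fun b => by
    have : l b ∈ {k : ℤ | 0 ≤ k ∧ k ≤ (N : ℤ) - 1} := hl.2 ▸ Set.mem_range_self b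
    exact this
  have hterm : ∀ p, rate β l p * lyap β (express p l) ≤
      lyapConst N * settleSteps N * Real.exp (-β) := by
    intro p
    have hwl := express_mem_lists p l
    have hK : (rank (express p l) : ℝ) ≤ settleSteps N := by exact_mod_cast rank_le hN2 hwl
    rcases Int.units_eq_one_or p.2 with ho | ho
    · by_cases hp : IsTop l p
      · rw [lyap_of_mem_ladders hN2 β (express_mem_ladders_of_isTop hN2 hl hp), mul_zero]
        positivity
      · obtain ⟨p₀, hp₀⟩ := exists_isTop l
        have hm : (p₀.2 : ℤ) * l p₀.1 ≤ N := by
          have h1 := units_mul_self_le_abs p₀.2 (l p₀.1)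
          rw [abs_of_nonneg (hmem _).1] at h1
          have := (hmem p₀.1).2
          omega
        have hr : rate β l p ≤ Real.exp (-β) * Real.exp (β * N) := by
          refine (rate_le_of_not_isTop β hp₀ hp).trans ?_
          have : (((p₀.2 : ℤ) * l p₀.1 : ℤ) : ℝ) ≤ N := by exact_mod_cast hm
          gcongr
        have hw : express p l ∈ orderly N := by
          obtain ⟨a, o⟩ := p
          obtain rfl : o = 1 := ho
          exact express_mem_orderly hi (fun b => by simpa using (hmem b).1) a
        rw [lyap_of_mem_orderly hN2 β hw]
        calc rate β l p * (lyapConst N * Real.exp (-(β * N)) * rank (express p l))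
            ≤ (Real.exp (-β) * Real.exp (β * N)) *
              (lyapConst N * Real.exp (-(β * N)) * settleSteps N) := by
              gcongr
          _ = lyapConst N * settleSteps N * Real.exp (-β) *
              (Real.exp (β * N) * Real.exp (-(β * N))) := by ring
          _ = lyapConst N * settleSteps N * Real.exp (-β) := by
              rw [← Real.exp_add, add_neg_cancel, Real.exp_zero, mul_one]
    · have hr : rate β l p ≤ 1 := by
        have h1 : (p.2 : ℤ) * l p.1 ≤ 0 := by
          rw [ho]
          have := (hmem p.1).1
          push_cast
          linarith
        exact (rate_le_exp β h1).trans_eq (by simp)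
      -- with three actors, two of the others have distinct entries, so the list is not null
      have hw0 : express p l ≠ 0 := by
        intro h
        have hval : ∀ b, b ≠ p.1 → l b = 1 := by
          intro b hb
          have := congrFun h b
          rw [express_eq_of_ne hb, ho] at this
          simp at this
          omega
        have hcard : 1 < (Finset.univ.erase p.1).card := by
          rw [Finset.card_erase_of_mem (Finset.mem_univ _), Finset.card_univ, Fintype.card_fin]
          omega
        obtain ⟨b, hb, c, hc, hbc⟩ := Finset.one_lt_card.1 hcard
        exact hbc (hi ((hval b (Finset.ne_of_mem_erase hb)).trans
          (hval c (Finset.ne_of_mem_erase hc)).symm))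
      have h1 := lyap_le hN2 β hwl
      rw [if_neg hw0, add_zero] at h1
      exact (mul_le_of_le_one_left (lyap_nonneg β _) hr).trans h1
  refine (Finset.sum_le_card_nsmul _ _ _ fun p _ => hterm p).trans_eq ?_
  rw [nsmul_eq_mul, Finset.card_univ]
  rfl

/-! ### The committor and the rate of consensus reversal -/

open Classical in
/-- The probability that the embedded chain started from `u` reaches a ladder within `n` steps, and
that the first ladder it reaches is negative. -/
def committorStep (β : ℝ≥0) : ℕ → (Fin N → ℤ) → ℝ
  | 0, u => if u ∈ negLadder N then 1 else 0
  | n + 1, u => if u ∈ ladders N then (if u ∈ negLadder N then 1 else 0) else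
      ∑ p, stepProb β u p * committorStep β n (express p u)

/-- The probability that the first ladder reached from `u` is negative. -/
def committor (β : ℝ≥0) (u : Fin N → ℤ) : ℝ := ⨆ n, committorStep β n u

theorem committorStep_mem_Icc [NeZero N] (β : ℝ≥0) (n : ℕ) (u : Fin N → ℤ) :
    0 ≤ committorStep β n u ∧ committorStep β n u ≤ 1 := by
  induction n generalizing u with
  | zero => simp only [committorStep]; split_ifs <;> norm_num
  | succ n ih =>
    simp only [committorStep]
    split_ifs
    · norm_num
    · norm_num
    · refine ⟨Finset.sum_nonneg fun p _ => mul_nonneg (stepProb_pos β u p).le (ih _).1, ?_⟩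
      rw [← sum_stepProb β u]
      exact Finset.sum_le_sum fun p _ =>
        mul_le_of_le_one_right (stepProb_pos β u p).le (ih _).2

theorem committorStep_mono [NeZero N] (β : ℝ≥0) (u : Fin N → ℤ) :
    Monotone fun n => committorStep β n u := by
  refine monotone_nat_of_le_succ fun n => ?_
  induction n generalizing u with
  | zero =>
    by_cases h : u ∈ ladders N
    · simp [committorStep, h]
    · have h' : u ∉ negLadder N := fun hn => h (Or.inr hn)
      have := (committorStep_mem_Icc β 1 u).1
      rw [committorStep, if_neg h']
      exact this
  | succ n ih =>
    rw [committorStep, committorStep]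
    split_ifs
    · exact le_rfl
    · exact le_rfl
    · exact Finset.sum_le_sum fun p _ =>
        mul_le_mul_of_nonneg_left (ih _) (stepProb_pos β u p).le

theorem tendsto_committorStep [NeZero N] (β : ℝ≥0) (u : Fin N → ℤ) :
    Tendsto (fun n => committorStep β n u) atTop (nhds (committor β u)) :=
  tendsto_atTop_ciSup (committorStep_mono β u)
    ⟨1, by rintro _ ⟨n, rfl⟩; exact (committorStep_mem_Icc β n u).2⟩

theorem committor_nonneg [NeZero N] (β : ℝ≥0) (u : Fin N → ℤ) : 0 ≤ committor β u :=
  ge_of_tendsto' (tendsto_committorStep β u) fun n => (committorStep_mem_Icc β n u).1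

theorem committor_le_one [NeZero N] (β : ℝ≥0) (u : Fin N → ℤ) : committor β u ≤ 1 :=
  le_of_tendsto' (tendsto_committorStep β u) fun n => (committorStep_mem_Icc β n u).2

open Classical in
theorem committor_of_mem_ladders [NeZero N] (β : ℝ≥0) {u : Fin N → ℤ} (hu : u ∈ ladders N) :
    committor β u = if u ∈ negLadder N then 1 else 0 := by
  refine tendsto_nhds_unique (tendsto_committorStep β u) (tendsto_const_nhds.congr fun n => ?_)
  cases n with
  | zero => rfl
  | succ n => rw [committorStep, if_pos hu]

theorem committor_harmonic [NeZero N] (β : ℝ≥0) {u : Fin N → ℤ} (hu : u ∉ ladders N) :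
    committor β u = ∑ p, stepProb β u p * committor β (express p u) := by
  refine tendsto_nhds_unique ((tendsto_add_atTop_iff_nat 1).2 (tendsto_committorStep β u)) ?_
  simp only [committorStep, if_neg hu]
  exact tendsto_finsetSum _ fun p _ => (tendsto_committorStep β _).const_mul _

/-- The rate at which the process leaves the positive ladder `l` for an excursion which ends on a
negative ladder. -/
def crossRate (β : ℝ≥0) (l : Fin N → ℤ) : ℝ := ∑ p, rate β l p * committor β (express p l)

/-- The error of the exponential approximation: a bound for the expected duration, per unit of time
spent on a positive ladder, of the excursions away from the ladders. -/
def excursionBound (N : ℕ) (β : ℝ≥0) : ℝ :=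
  numMarks N * (lyapConst N * settleSteps N * Real.exp (-β))

theorem tendsto_exp_neg_coe : Tendsto (fun β : ℝ≥0 => Real.exp (-(β : ℝ))) atTop (nhds 0) :=
  Real.tendsto_exp_neg_atTop_nhds_zero.comp (NNReal.tendsto_coe_atTop.2 tendsto_id)

theorem tendsto_excursionBound : Tendsto (excursionBound N) atTop (nhds 0) := by
  have := (tendsto_exp_neg_coe.const_mul (lyapConst N * settleSteps N)).const_mul (numMarks N)
  simp only [mul_zero] at this
  exact this

/-- From a list `v`, the hitting time of the negative ladders is close to zero if the first ladder
reached is negative, and close in law to the hitting time from a positive ladder otherwise. The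
error is at most `|t|` times the expected time to reach the ladders, bounded by `lyap β v`; both
sides are compared by the maximum principle, without reference to that time. -/
theorem norm_charFun_sub_le [NeZero N] (hN : 3 ≤ N) {β : ℝ≥0}
    (hβ : lyapConst N * settleSteps N * Real.exp (-β) ≤ 1 / 2) {l : Fin N → ℤ}
    (hl : l ∈ posLadder N) (t : ℝ) {v : Fin N → ℤ} (hv : v ∈ lists N) :
    ‖charFun (hitLaw β v) t - (committor β v + charFun (hitLaw β l) t * (1 - committor β v))‖ ≤
      |t| * lyap β v := by
  have hN2 : 2 ≤ N := by omega
  set a := charFun (hitLaw β l) t with ha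
  set D : (Fin N → ℤ) → ℂ :=
    fun v => charFun (hitLaw β v) t - (committor β v + a * (1 - committor β v)) with hD
  set X : (Fin N → ℤ) → ℝ := fun v => ‖D v‖ - |t| * lyap β v with hX
  have hlyap := fun w : Fin N → ℤ => mul_nonneg (abs_nonneg t) (lyap_nonneg β w)
  suffices X v ≤ 0 from sub_nonpos.1 this
  refine nonpos_of_subharmonic β (B := ladders N) Set.subset_union_right (X := X)
    (C := 1 + (1 + 1 * 1)) ?_ ?_ ?_ hv
  · intro w _
    have h1 : ‖(committor β w : ℂ)‖ ≤ 1 := by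
      rw [Complex.norm_real, Real.norm_of_nonneg (committor_nonneg β w)]
      exact committor_le_one β w
    have h2 : ‖(1 - committor β w : ℂ)‖ ≤ 1 := by
      rw [← Complex.ofReal_one, ← Complex.ofReal_sub, Complex.norm_real,
        Real.norm_of_nonneg (sub_nonneg.2 (committor_le_one β w))]
      linarith [committor_nonneg β w]
    have h3 : ‖D w‖ ≤ 1 + (1 + 1 * 1) := by
      refine (norm_sub_le _ _).trans (add_le_add (norm_charFun_le_one _)
        ((norm_add_le _ _).trans (add_le_add h1 ?_)))
      rw [norm_mul]
      exact mul_le_mul (norm_charFun_le_one _) h2 (norm_nonneg _) zero_le_one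
    simp only [hX]
    linarith [hlyap w]
  · intro w _ hw
    have hDw : D w = 0 := by
      simp only [hD, committor_of_mem_ladders β hw]
      by_cases hn : w ∈ negLadder N
      · simp [hn, hitLaw_of_mem β hn]
      · have hp : w ∈ posLadder N := hw.resolve_right hn
        simp [hn, ha, hitLaw_eq_of_mem_posLadder β hl hp]
    simp only [hX, hDw, norm_zero]
    linarith [hlyap w]
  · intro w hwl hw
    have hneg : w ∉ negLadder N := fun h => hw (Or.inr h)
    have hΛ := totalRate_pos β w
    have h1 := resolvent_charFun_hitLaw β hneg t
    have h2 : (totalRate β w : ℂ) * committor β w =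
        ∑ p, (rate β w p : ℂ) * committor β (express p w) := by
      rw [committor_harmonic β hw]
      push_cast
      rw [Finset.mul_sum]
      refine Finset.sum_congr rfl fun p _ => ?_
      rw [← mul_assoc, ← Complex.ofReal_mul, totalRate_mul_stepProb]
    have h3 : (totalRate β w : ℂ) = ∑ p, (rate β w p : ℂ) := by
      simp [totalRate]
    have h4 : ∑ p, (rate β w p : ℂ) * D (express p w) =
        ∑ p, (rate β w p : ℂ) * charFun (hitLaw β (express p w)) t -
          ((∑ p, (rate β w p : ℂ) * committor β (express p w)) * (1 - a) +
            (∑ p, (rate β w p : ℂ)) * a) := by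
      rw [Finset.sum_mul, Finset.sum_mul, ← Finset.sum_add_distrib, ← Finset.sum_sub_distrib]
      exact Finset.sum_congr rfl fun p _ => by simp only [hD]; ring
    have h5 : totalRate β w * D w = ∑ p, (rate β w p : ℂ) * D (express p w) +
        t * Complex.I * charFun (hitLaw β w) t := by
      rw [h4, ← h1, ← h2, ← h3]
      simp only [hD]
      ring
    have h6 : totalRate β w * ‖D w‖ ≤ ∑ p, rate β w p * ‖D (express p w)‖ + |t| := by
      have h7 : ‖(totalRate β w : ℂ) * D w‖ = totalRate β w * ‖D w‖ := by
        rw [norm_mul, Complex.norm_real, Real.norm_of_nonneg hΛ.le]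
      rw [← h7, h5]
      refine (norm_add_le _ _).trans (add_le_add ((norm_sum_le _ _).trans_eq ?_) ?_)
      · exact Finset.sum_congr rfl fun p _ => by
          rw [norm_mul, Complex.norm_real, Real.norm_of_nonneg (rate_pos β w p).le]
      · rw [norm_mul, norm_mul, Complex.norm_I, mul_one, Complex.norm_real, Real.norm_eq_abs]
        exact mul_le_of_le_one_right (abs_nonneg t) (norm_charFun_le_one _)
    have h8 : ∑ p, rate β w p * lyap β (express p w) + 1 ≤ totalRate β w * lyap β w := by
      have := lyap_drift hN hβ hwl hw
      simp only [mul_sub, Finset.sum_sub_distrib, ← Finset.sum_mul] at this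
      rw [totalRate]
      linarith
    have h9 : totalRate β w * X w ≤ ∑ p, rate β w p * X (express p w) := by
      have h10 : ∑ p, rate β w p * X (express p w) = ∑ p, rate β w p * ‖D (express p w)‖ -
          |t| * ∑ p, rate β w p * lyap β (express p w) := by
        rw [Finset.mul_sum, ← Finset.sum_sub_distrib]
        exact Finset.sum_congr rfl fun p _ => by simp only [hX]; ring
      have h11 := mul_le_mul_of_nonneg_left h8 (abs_nonneg t)
      rw [h10]
      simp only [hX]
      linarith
    simp only [stepProb, div_mul_eq_mul_div]
    rw [← Finset.sum_div, le_div_iff₀ hΛ, mul_comm]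
    exact h9

/-- The resolvent equation at a positive ladder, in which the hitting laws from its neighbours are
replaced by their approximation. -/
theorem norm_charFun_mul_sub_le [NeZero N] (hN : 3 ≤ N) {β : ℝ≥0}
    (hβ : lyapConst N * settleSteps N * Real.exp (-β) ≤ 1 / 2) {l : Fin N → ℤ}
    (hl : l ∈ posLadder N) (t : ℝ) :
    ‖charFun (hitLaw β l) t * (crossRate β l - t * Complex.I) - crossRate β l‖ ≤
      |t| * excursionBound N β := by
  have hneg := notMem_negLadder_of_mem_posLadder (by omega) hl
  have h1 := resolvent_charFun_hitLaw β hneg t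
  set a := charFun (hitLaw β l) t with ha
  set D : (Fin N → ℤ) → ℂ :=
    fun v => charFun (hitLaw β v) t - (committor β v + a * (1 - committor β v)) with hD
  have h3 : (totalRate β l : ℂ) = ∑ p, (rate β l p : ℂ) := by
    simp [totalRate]
  have h4 : ∑ p, (rate β l p : ℂ) * D (express p l) =
      ∑ p, (rate β l p : ℂ) * charFun (hitLaw β (express p l)) t -
        ((∑ p, (rate β l p : ℂ) * committor β (express p l)) * (1 - a) +
          (∑ p, (rate β l p : ℂ)) * a) := by
    rw [Finset.sum_mul, Finset.sum_mul, ← Finset.sum_add_distrib, ← Finset.sum_sub_distrib]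
    exact Finset.sum_congr rfl fun p _ => by simp only [hD]; ring
  have h5 : a * (crossRate β l - t * Complex.I) - crossRate β l =
      ∑ p, (rate β l p : ℂ) * D (express p l) := by
    rw [h4, ← h1, ← h3, crossRate]
    push_cast
    ring
  rw [h5]
  refine (norm_sum_le _ _).trans ?_
  have h6 := mul_le_mul_of_nonneg_left (lyap_bound_at_posLadder hN β hl) (abs_nonneg t)
  refine le_trans ?_ h6
  rw [Finset.mul_sum]
  refine Finset.sum_le_sum fun p _ => ?_
  rw [norm_mul, Complex.norm_real, Real.norm_of_nonneg (rate_pos β l p).le, mul_left_comm]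
  exact mul_le_mul_of_nonneg_left (norm_charFun_sub_le hN hβ hl t (express_mem_lists p l))
    (rate_pos β l p).le

theorem crossRate_nonneg [NeZero N] (β : ℝ≥0) (l : Fin N → ℤ) : 0 ≤ crossRate β l :=
  Finset.sum_nonneg fun p _ => mul_nonneg (rate_pos β l p).le (committor_nonneg β _)

/-- If the crossing rate were zero, the hitting time would have a characteristic function bounded
by `excursionBound N β < 1` off the origin, against its continuity at the origin. -/
theorem crossRate_pos [NeZero N] (hN : 3 ≤ N) {β : ℝ≥0}
    (hβ : lyapConst N * settleSteps N * Real.exp (-β) ≤ 1 / 2) (hδ : excursionBound N β < 1)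
    {l : Fin N → ℤ} (hl : l ∈ posLadder N) : 0 < crossRate β l := by
  refine lt_of_le_of_ne (crossRate_nonneg β l) fun h0 => ?_
  have hle : ∀ t : ℝ, t ≠ 0 → ‖charFun (hitLaw β l) t‖ ≤ excursionBound N β := by
    intro t ht
    have h := norm_charFun_mul_sub_le hN hβ hl t
    rw [← h0, Complex.ofReal_zero, zero_sub, sub_zero, norm_mul, norm_neg, norm_mul,
      Complex.norm_I, mul_one, Complex.norm_real, Real.norm_eq_abs, mul_comm] at h
    exact le_of_mul_le_mul_left h (abs_pos.2 ht)
  have hc : Tendsto (fun t => ‖charFun (hitLaw β l) t‖) (nhdsWithin 0 {0}ᶜ) (nhds 1) := by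
    have h := (continuous_charFun (μ := hitLaw β l)).norm.tendsto (0 : ℝ)
    rw [charFun_zero, probReal_univ, Complex.ofReal_one, norm_one] at h
    exact h.mono_left nhdsWithin_le_nhds
  have := le_of_tendsto hc (eventually_nhdsWithin_of_forall fun t ht => hle t ht)
  linarith

/-- In units of the inverse crossing rate, the hitting time is exponential up to
`excursionBound N β`. -/
theorem norm_charFun_crossRate_sub_le [NeZero N] (hN : 3 ≤ N) {β : ℝ≥0}
    (hβ : lyapConst N * settleSteps N * Real.exp (-β) ≤ 1 / 2) (hδ : excursionBound N β < 1)
    {l : Fin N → ℤ} (hl : l ∈ posLadder N) (x : ℝ) :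
    ‖charFun (hitLaw β l) (crossRate β l * x) - charFun (expMeasure 1) x‖ ≤
      |x| * excursionBound N β := by
  have hκ := crossRate_pos hN hβ hδ hl
  have hne := sub_mul_I_ne_zero one_pos x
  have h1 := le_norm_sub_mul_I one_pos x
  have h := norm_charFun_mul_sub_le hN hβ hl (crossRate β l * x)
  set a := charFun (hitLaw β l) (crossRate β l * x)
  have h2 : a * (crossRate β l - (crossRate β l * x : ℝ) * Complex.I) - crossRate β l =
      crossRate β l * ((a - charFun (expMeasure 1) x) * ((1 : ℝ) - x * Complex.I)) := by
    rw [charFun_expMeasure one_pos, sub_mul, div_mul_cancel₀ _ hne]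
    push_cast
    ring
  rw [h2, norm_mul, Complex.norm_real, Real.norm_of_nonneg hκ.le, abs_mul, abs_of_pos hκ,
    mul_assoc, norm_mul] at h
  have h3 := le_of_mul_le_mul_left h hκ
  exact (le_mul_of_one_le_right (norm_nonneg _) h1).trans h3

/-! ### Convergence to the exponential law -/

theorem eventually_small [NeZero N] : ∀ᶠ β : ℝ≥0 in atTop,
    lyapConst N * settleSteps N * Real.exp (-β) ≤ 1 / 2 ∧ excursionBound N β < 1 := by
  have h1 := tendsto_exp_neg_coe.const_mul (lyapConst N * settleSteps N)
  rw [mul_zero] at h1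
  exact (h1.eventually (ge_mem_nhds (by norm_num))).and
    (tendsto_excursionBound.eventually (gt_mem_nhds one_pos))

/-- The argument `f β` is allowed to vary with `β`, as it does when the hitting time is divided by
its quantile. -/
theorem tendsto_charFun_crossRate [NeZero N] (hN : 3 ≤ N) {l : Fin N → ℤ}
    (hl : l ∈ posLadder N) {f : ℝ≥0 → ℝ} {x : ℝ} (hf : Tendsto f atTop (nhds x)) :
    Tendsto (fun β => charFun (hitLaw β l) (crossRate β l * f β)) atTop
      (nhds (charFun (expMeasure 1) x)) := by
  have h1 : Tendsto (fun β => charFun (expMeasure 1) (f β)) atTop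
      (nhds (charFun (expMeasure 1) x)) :=
    ((continuous_charFun (μ := expMeasure 1)).tendsto x).comp hf
  have h2 : Tendsto (fun β => charFun (hitLaw β l) (crossRate β l * f β) -
      charFun (expMeasure 1) (f β)) atTop (nhds 0) := by
    have h3 : Tendsto (fun β => |f β| * excursionBound N β) atTop (nhds 0) := by
      simpa using hf.abs.mul (tendsto_excursionBound (N := N))
    refine squeeze_zero_norm' ?_ h3
    filter_upwards [eventually_small (N := N)] with β hβ
    exact norm_charFun_crossRate_sub_le hN hβ.1 hβ.2 hl _
  simpa using h2.add h1

theorem tendsto_of_tendsto_charFun_atTop {μ : ℝ≥0 → ProbabilityMeasure ℝ}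
    {ν : ProbabilityMeasure ℝ}
    (h : ∀ t : ℝ, Tendsto (fun β => charFun (μ β : Measure ℝ) t) atTop
      (nhds (charFun (ν : Measure ℝ) t))) : Tendsto μ atTop (nhds ν) :=
  tendsto_of_seq_tendsto fun _ hs =>
    ProbabilityMeasure.tendsto_of_tendsto_charFun fun t => (h t).comp hs

theorem tendsto_hitLaw_tail [NeZero N] (hN : 3 ≤ N) {l : Fin N → ℤ} (hl : l ∈ posLadder N)
    {y : ℝ} (hy : 0 ≤ y) : Tendsto (fun β => hitLaw β l {x | y < crossRate β l * x}) atTop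
      (nhds (ENNReal.ofReal (Real.exp (-y)))) := by
  have hm : ∀ β : ℝ≥0, Measurable fun x => crossRate β l * x := fun β => by fun_prop
  let μ : ℝ≥0 → ProbabilityMeasure ℝ := fun β => ⟨(hitLaw β l).map (crossRate β l * ·),
    Measure.isProbabilityMeasure_map (hm β).aemeasurable⟩
  let ν : ProbabilityMeasure ℝ := ⟨expMeasure 1, inferInstance⟩
  have h1 : Tendsto μ atTop (nhds ν) := by
    refine tendsto_of_tendsto_charFun_atTop fun t => ?_
    simp only [μ, ν, ProbabilityMeasure.coe_mk, charFun_map_mul]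
    exact tendsto_charFun_crossRate hN hl tendsto_const_nhds
  have h2 := ProbabilityMeasure.tendsto_measure_of_null_frontier_of_tendsto' h1
    (E := Set.Ioi y) (by rw [frontier_Ioi]; exact measure_singleton (μ := expMeasure 1) y)
  simp only [μ, ν, ProbabilityMeasure.coe_mk, expMeasure_Ioi one_pos hy, one_mul] at h2
  refine h2.congr fun β => ?_
  rw [Measure.map_apply (hm β) measurableSet_Ioi]
  rfl

/-- The tail of `crossRate β l` times the hitting time converges to `exp (-y)` at each `y ≥ 0`, so
its quantile of order `exp (-1)` converges to `1`. -/
theorem tendsto_quantile_mul_crossRate [NeZero N] (hN : 3 ≤ N) {l : Fin N → ℤ}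
    (hl : l ∈ posLadder N) {c : ℝ≥0 → ℝ}
    (hc : ∀ β, hitLaw β l (Set.Ioi (c β)) = ENNReal.ofReal (Real.exp (-1))) :
    Tendsto (fun β => crossRate β l * c β) atTop (nhds 1) := by
  have hκ : ∀ᶠ β in atTop, 0 < crossRate β l := by
    filter_upwards [eventually_small (N := N)] with β hβ using crossRate_pos hN hβ.1 hβ.2 hl
  refine tendsto_order.2 ⟨fun y hy => ?_, fun y hy => ?_⟩
  · have hy' : max y 0 < 1 := max_lt hy one_pos
    have hlt : ENNReal.ofReal (Real.exp (-1)) < ENNReal.ofReal (Real.exp (-(max y 0))) :=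
      (ENNReal.ofReal_lt_ofReal_iff (Real.exp_pos _)).2 (Real.exp_lt_exp.2 (by linarith))
    filter_upwards [hκ, (tendsto_hitLaw_tail hN hl (le_max_right y 0)).eventually
      (lt_mem_nhds hlt)] with β hβ h
    by_contra hle
    rw [← hc β] at h
    refine h.not_ge (measure_mono fun x hx => ?_)
    have h1 : crossRate β l * c β ≤ max y 0 := (not_lt.1 hle).trans (le_max_left _ _)
    exact lt_of_mul_lt_mul_left (h1.trans_lt hx) hβ.le
  · have hlt : ENNReal.ofReal (Real.exp (-y)) < ENNReal.ofReal (Real.exp (-1)) :=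
      (ENNReal.ofReal_lt_ofReal_iff (Real.exp_pos _)).2 (Real.exp_lt_exp.2 (by linarith))
    filter_upwards [hκ, (tendsto_hitLaw_tail hN hl (by linarith : 0 ≤ y)).eventually
      (gt_mem_nhds hlt)] with β hβ h
    by_contra hle
    rw [← hc β] at h
    refine h.not_ge (measure_mono fun x hx => ?_)
    exact (not_lt.1 hle).trans_lt (mul_lt_mul_of_pos_left hx hβ)

theorem ae_reachTime_eq_hitTime [NeZero N] (β : ℝ≥0) {u : Fin N → ℤ} (hu : u ∉ negLadder N) :
    reachTime β u (negLadder N) =ᵐ[prob N] hitTime β (negLadder N) u := by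
  filter_upwards [ae_pos_sample N] with ω hω using reachTime_eq_hitTime β hu hω

theorem prob_lt_reachTime [NeZero N] (β : ℝ≥0) {u : Fin N → ℤ} (hl : u ∈ lists N)
    (hu : u ∉ negLadder N) {x : ℝ} (hx : 0 < x) :
    prob N {ω | ENNReal.ofReal x < reachTime β u (negLadder N) ω} = hitLaw β u (Set.Ioi x) := by
  rw [hitLaw, Measure.map_apply (measurable_toReal_hitTime β _ u) measurableSet_Ioi]
  refine measure_congr ?_
  filter_upwards [ae_reachTime_eq_hitTime β hu, ae_hitTime_lt_top β subset_rfl hl] with ω h1 h2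
  refine propext ?_
  change ENNReal.ofReal x < reachTime β u (negLadder N) ω ↔ x < _
  rw [h1, ENNReal.ofReal_lt_iff_lt_toReal hx.le h2.ne]

theorem map_reachTime_div [NeZero N] (β : ℝ≥0) {u : Fin N → ℤ} (hu : u ∉ negLadder N) (c : ℝ) :
    (prob N).map (fun ω => (reachTime β u (negLadder N) ω).toReal / c) =
      (hitLaw β u).map (c⁻¹ * ·) := by
  rw [hitLaw, Measure.map_map (by fun_prop) (measurable_toReal_hitTime β _ u)]
  refine Measure.map_congr ?_
  filter_upwards [ae_reachTime_eq_hitTime β hu] with ω h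
  simp only [h, Function.comp_apply]
  rw [div_eq_inv_mul]

theorem tendstoInDistribution_reachTime_div [NeZero N] (hN : 3 ≤ N) {l : Fin N → ℤ}
    (hl : l ∈ posLadder N) {c : ℝ≥0 → ℝ} (hc0 : ∀ β, 0 < c β)
    (hc : ∀ β, hitLaw β l (Set.Ioi (c β)) = ENNReal.ofReal (Real.exp (-1))) :
    TendstoInDistribution
      (fun (β : ℝ≥0) (ω : Sample N) => (reachTime β l (negLadder N) ω).toReal / c β)
      atTop (id : ℝ → ℝ) (fun _ => prob N) (expMeasure 1) := by
  have hneg := notMem_negLadder_of_mem_posLadder (by omega) hl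
  refine ⟨fun β => ?_, aemeasurable_id, ?_⟩
  · exact ((measurable_hitTime β _ l).aemeasurable.congr
      (ae_reachTime_eq_hitTime β hneg).symm).ennreal_toReal.div_const _
  · refine tendsto_of_tendsto_charFun_atTop fun t => ?_
    simp only [ProbabilityMeasure.coe_mk, Measure.map_id, map_reachTime_div _ hneg,
      charFun_map_mul]
    have h1 : Tendsto (fun β => t / (crossRate β l * c β)) atTop (nhds t) := by
      have h := (tendsto_const_nhds (x := t)).div
        (tendsto_quantile_mul_crossRate hN hl hc) one_ne_zero
      rw [div_one] at h
      exact h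
    refine (tendsto_charFun_crossRate hN hl h1).congr' ?_
    filter_upwards [eventually_small (N := N)] with β hβ
    have hκ := crossRate_pos hN hβ.1 hβ.2 hl
    have hcβ := hc0 β
    congr 1
    field_simp

theorem val_mem_posLadder [NeZero N] : (fun b : Fin N => ((b : ℕ) : ℤ)) ∈ posLadder N := by
  have hN : 0 < N := Nat.pos_of_ne_zero (NeZero.ne N)
  refine ⟨⟨⟨0, hN⟩, by simp⟩, ?_⟩
  ext k
  simp only [Set.mem_range, Set.mem_ofPred_eq]
  constructor
  · rintro ⟨b, rfl⟩
    omega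
  · rintro ⟨h0, h1⟩
    exact ⟨⟨k.toNat, by omega⟩, by simp [h0]⟩

end SocialNetwork

end

theorem mainTheorem4 (N : ℕ) [NeZero N] (hN : 3 ≤ N) :
    (∀ β : ℝ≥0, ∀ l ∈ SocialNetwork.posLadder N, ∀ᵐ ω ∂(SocialNetwork.prob N),
      SocialNetwork.reachTime β l (SocialNetwork.negLadder N) ω < ∞) ∧
    ∃ c : ℝ≥0 → ℝ,
      (∀ β : ℝ≥0, 0 < c β) ∧
      (∀ β : ℝ≥0, ∀ l ∈ SocialNetwork.posLadder N, ∀ x : ℝ, 0 < x →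
        (SocialNetwork.prob N
            {ω | ENNReal.ofReal x < SocialNetwork.reachTime β l (SocialNetwork.negLadder N) ω} =
          ENNReal.ofReal (Real.exp (-1)) ↔ x = c β)) ∧
      ∀ l ∈ SocialNetwork.posLadder N,
        TendstoInDistribution
          (fun (β : ℝ≥0) (ω : SocialNetwork.Sample N) =>
            (SocialNetwork.reachTime β l (SocialNetwork.negLadder N) ω).toReal / c β)
          atTop (id : ℝ → ℝ) (fun _ => SocialNetwork.prob N) (expMeasure 1) := by
  have hneg : ∀ l ∈ SocialNetwork.posLadder N, l ∉ SocialNetwork.negLadder N := fun l hl =>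
    SocialNetwork.notMem_negLadder_of_mem_posLadder (by omega) hl
  have hl₀ := SocialNetwork.val_mem_posLadder (N := N)
  choose c hc0 hc using fun β : ℝ≥0 => SocialNetwork.exists_quantile_hitLaw β (hneg _ hl₀)
    (Real.exp_pos (-1)) (Real.exp_lt_one_iff.2 (by norm_num : (-1 : ℝ) < 0))
  refine ⟨fun β l hl => ?_, c, hc0, fun β l hl x hx => ?_, fun l hl => ?_⟩
  · filter_upwards [SocialNetwork.ae_reachTime_eq_hitTime β (hneg l hl),
      SocialNetwork.ae_hitTime_lt_top β subset_rfl hl.1] with ω h1 h2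
    rwa [h1]
  · rw [SocialNetwork.prob_lt_reachTime β hl.1 (hneg l hl) hx,
      SocialNetwork.hitLaw_eq_of_mem_posLadder β hl₀ hl]
    exact hc β x hx
  · refine SocialNetwork.tendstoInDistribution_reachTime_div hN hl hc0 fun β => ?_
    rw [SocialNetwork.hitLaw_eq_of_mem_posLadder β hl₀ hl]
    exact (hc β (c β) (hc0 β)).2 rfl
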